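/- **Setting.** Let $Q=[0,1]^2$, with the max norm on $\mathbf R^2$. Let $\{E_i\}$ be a countable collection of closed curvilinear rectangles $E_i=\{(x,y): 0\le y\le 1,\ \ell_i(y)\le x\le r_i(y)\}\subset Q$ of full height, where $\ell_i<r_i$ are continuous functions on $[0,1]$, and let $f_i$ be a $C^2$ diffeomorphism, defined on an open neighbourhood of $E_i$, such that $S_i=f_i(E_i)\subset Q$ and $f_i$ maps the left and right sides of $E_i$ (the graphs of $\ell_i$ and $r_i$) into the vertical sides $\{0\}\times[0,1]$, $\{1\}\times[0,1]$ of $Q$. Write $F=f_i=(F_1,F_2)$ on $E_i$, and $F_{jx},F_{jy}$ for the partial derivatives. For $z\in Q$ let $\delta_z(E_i)$ be the diameter of the horizontal section of $E_i$ through $z$, and let $\delta_{i,\max},\delta_{i,\min}$ be its maximum and minimum over $z\in Q$. Assume: * G1. $\operatorname{int}E_i\cap\operatorname{int}E_j=\emptyset$ and $\operatorname{int}S_i\cap\operatorname{int}S_j=\emptyset$ for $i\ne j$. G2. $Q\setminus\bigcup_i\operatorname{int}E_i$ has Lebesgue measure $0$. G3. $-\sum_i\delta_{i,\max}\log\delta_{i,\min}<\infty$.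 * There are constants $0<\alpha<1$ and $K_0>1$ such that for all $i$ and all $z\in E_i$: H1. $|F_{2x}|+\alpha|F_{2y}|+\alpha^2|F_{1y}|\le\alpha|F_{1x}|$; H2. $|F_{1x}|-\alpha|F_{1y}|\ge K_0$; H3. $|F_{1y}|+\alpha|F_{2y}|+\alpha^2|F_{2x}|\le\alpha|F_{1x}|$; H4. $|F_{1x}|-\alpha|F_{2x}|\ge J_FK_0$, where $J_F=|F_{1x}F_{2y}-F_{1y}F_{2x}|$; and H5. $K_0^{-2}+\alpha^2<1$. * D2. There is $C_0>0$ such that $|D^2f_i(z)|/|\partial_xf_i(z)|<C_0$ for all $i$ and all $z\in E_i$, where $|D^2f_i|$ is the maximum of the absolute values of all second partial derivatives of the two coordinates of $f_i$. **Symbolic description.** Put $E_{i_0\dots i_{n-1}}=E_{i_0}\cap f_{i_0}^{-1}E_{i_1\dots i_{n-1}}$ and $S_{i_{-m}\dots i_{-1}}=f_{i_{-1}}(S_{i_{-m}\dots i_{-2}}\cap E_{i_{-1}})$. The stable manifold of a future $(i_0i_1\dots)$ is $\bigcap_nE_{i_0\dots i_{n-1}}$, and the unstable manifold of a past $(\dots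 i_{-2}i_{-1})$ is $\bigcap_mS_{i_{-m}\dots i_{-1}}$. For a two-sided sequence $\omega=(i_k)_{k\in\mathbf Z}$ let $\pi(\omega)$ be the intersection point of the stable manifold of its future and the unstable manifold of its past, let $a(\omega)$ be the slope of this unstable manifold at $\pi(\omega)$, and put $D^uF(\omega)=|Df_{i_0}(\pi(\omega))(1,a(\omega))|$ and $\phi(\omega)=-\log D^uF(\omega)$. Let $\sigma$ be the left shift. Fix an unstable manifold $W_0^u$, given by a past $\eta$; for $\omega$ with future $x$ let $\omega_0$ be the sequence with past $\eta$ and future $x$, so that $\pi(\omega_0)=W^s(\pi(\omega))\cap W_0^u$. Put $$u(\omega)=\sum_{k=0}^\infty\bigl(\phi(\sigma^k\omega)-\phi(\sigma^k\omega_0)\bigr),\qquad \psi(\omega)=\phi(\omega)-u(\omega)+u(\sigma\omega).$$ **Corollary 5.10.** These objects are well defined: each unstable manifold is the graph of a $C^1$ function $y(x)$, $0\le x\le1$, with $|dy/dx|\le\alpha$; each $\omega$ determines exactly one point $\pi(\omega)$, and $f_{i_0}(\pi(\omega))=\pi(\sigma\omega)$; the series $u$ converges for every $\omega$ (unconditionally),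 and uniformly in $\omega$; and $\psi(\omega)$ depends only on the future $(i_0i_1\dots)$ of $\omega$, hence defines a function $\phi^u$ on the space $\Omega_+$ of one-sided sequences. The function $\phi^u$ is locally Hölder on $\Omega_+$: there are $C>0$ and $0<\theta<1$ such that for all $n\ge1$ $$V_n(\phi^u)=\sup\{|\phi^u(x)-\phi^u(y)|:\ x_k=y_k,\ k=0,\dots,n-1\}<C\theta^n .$$ -/

import Mathlib

open Set Filter Topology MeasureTheory

noncomputable section

namespace HyperbolicModel

/-! ## The plane

`ℝ × ℝ` carries the max norm `‖(v₁, v₂)‖ = max |v₁| |v₂|` in Mathlib, which is the norm used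
throughout. -/

/-- The closed unit square `Q`. -/
def unitSquare : Set (ℝ × ℝ) := Icc (0 : ℝ) 1 ×ˢ Icc (0 : ℝ) 1

/-- The vector `∂g/∂x = (g₁ₓ, g₂ₓ)`. -/
def partialX (g : ℝ × ℝ → ℝ × ℝ) (z : ℝ × ℝ) : ℝ × ℝ := fderiv ℝ g z (1, 0)

/-- The vector `∂g/∂y = (g₁ᵧ, g₂ᵧ)`. -/
def partialY (g : ℝ × ℝ → ℝ × ℝ) (z : ℝ × ℝ) : ℝ × ℝ := fderiv ℝ g z (0, 1)

/-- Absolute value of the Jacobian determinant. -/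
def absJacobian (g : ℝ × ℝ → ℝ × ℝ) (z : ℝ × ℝ) : ℝ :=
  |(partialX g z).1 * (partialY g z).2 - (partialY g z).1 * (partialX g z).2|

/-- `|D²g(z)|`: the maximum of the absolute values of all second partial derivatives of both
coordinates of `g` (the max over the two coordinates is the norm of `ℝ × ℝ`). -/
def secondDerivMax (g : ℝ × ℝ → ℝ × ℝ) (z : ℝ × ℝ) : ℝ :=
  max ‖partialX (partialX g) z‖ (max ‖partialY (partialX g) z‖ ‖partialY (partialY g) z‖)

/-- The `z`-width `δ_z(E)`: diameter of the section of `E` by the horizontal line through `z`. -/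
def width (E : Set (ℝ × ℝ)) (z : ℝ × ℝ) : ℝ := Metric.diam ({w | w.2 = z.2} ∩ E)

/-- `max_{z ∈ Q} δ_z(E)`. -/
def maxWidth (E : Set (ℝ × ℝ)) : ℝ := sSup (width E '' unitSquare)

/-- `min_{z ∈ Q} δ_z(E)`. -/
def minWidth (E : Set (ℝ × ℝ)) : ℝ := sInf (width E '' unitSquare)

end HyperbolicModel

open HyperbolicModel in
/-- A family of full height curvilinear rectangles `E_i` in the unit square `Q`, together with
`C²` diffeomorphisms `f_i`, each defined on an open neighbourhood of `E_i`, which map `E_i` into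
`Q` and the two lateral sides of `E_i` into the two vertical sides of `Q`.

`E_i` is bounded by its lateral sides, the graphs `x = left i y` and `x = right i y`, and by
segments of the bottom and of the top of `Q`. Under the hyperbolicity conditions the lateral sides
are automatically smooth, with slope at most `α`, and `f_i (E_i)` is automatically a full width
strip, bounded above and below by graphs over `[0, 1]` of slope at most `α`; nothing of this is
required here. -/
structure HyperbolicModel (ι : Type*) where
  left : ι → ℝ → ℝ
  right : ι → ℝ → ℝ
  continuousOn_left : ∀ i, ContinuousOn (left i) (Icc 0 1)
  continuousOn_right : ∀ i, ContinuousOn (right i) (Icc 0 1)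
  left_nonneg : ∀ i, ∀ y ∈ Icc (0 : ℝ) 1, 0 ≤ left i y
  left_lt_right : ∀ i, ∀ y ∈ Icc (0 : ℝ) 1, left i y < right i y
  right_le_one : ∀ i, ∀ y ∈ Icc (0 : ℝ) 1, right i y ≤ 1
  f : ι → OpenPartialHomeomorph (ℝ × ℝ) (ℝ × ℝ)
  contDiffOn_f : ∀ i, ContDiffOn ℝ 2 (f i) (f i).source
  contDiffOn_symm : ∀ i, ContDiffOn ℝ 2 (f i).symm (f i).target
  subset_source : ∀ i,
    {z : ℝ × ℝ | z.2 ∈ Icc (0 : ℝ) 1 ∧ left i z.2 ≤ z.1 ∧ z.1 ≤ right i z.2} ⊆ (f i).source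
  mapsTo_unitSquare : ∀ i,
    MapsTo (f i) {z : ℝ × ℝ | z.2 ∈ Icc (0 : ℝ) 1 ∧ left i z.2 ≤ z.1 ∧ z.1 ≤ right i z.2}
      unitSquare
  f_left : ∀ i, ∀ y ∈ Icc (0 : ℝ) 1, (f i (left i y, y)).1 = 0 ∨ (f i (left i y, y)).1 = 1
  f_right : ∀ i, ∀ y ∈ Icc (0 : ℝ) 1, (f i (right i y, y)).1 = 0 ∨ (f i (right i y, y)).1 = 1

namespace HyperbolicModel

variable {ι : Type*}

/-- The full height rectangle `E_i`. -/
def E (M : HyperbolicModel ι) (i : ι) : Set (ℝ × ℝ) :=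
  {z | z.2 ∈ Icc (0 : ℝ) 1 ∧ M.left i z.2 ≤ z.1 ∧ z.1 ≤ M.right i z.2}

/-- The full width strip `S_i = f_i (E_i)`. -/
def S (M : HyperbolicModel ι) (i : ι) : Set (ℝ × ℝ) := M.f i '' M.E i

/-- Geometric conditions: G1 (disjoint interiors), G2 (the `E_i` fill `Q` up to a null set),
G3 (`-∑ δ_{i,max} log δ_{i,min} < ∞`, a series of nonnegative terms). -/
structure Geometric (M : HyperbolicModel ι) : Prop where
  disjoint_E : ∀ i j, i ≠ j → Disjoint (interior (M.E i)) (interior (M.E j))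
  disjoint_S : ∀ i j, i ≠ j → Disjoint (interior (M.S i)) (interior (M.S j))
  full_measure : volume (unitSquare \ ⋃ i, interior (M.E i)) = 0
  summable_width : Summable fun i => -(maxWidth (M.E i) * Real.log (minWidth (M.E i)))

/-- Hyperbolicity conditions H1, H2, H3, H4, for all `z ∈ E_i` and all `i`. -/
structure Hyperbolic (M : HyperbolicModel ι) (α K₀ : ℝ) : Prop where
  h1 : ∀ i, ∀ z ∈ M.E i,
    |(partialX (M.f i) z).2| + α * |(partialY (M.f i) z).2| + α ^ 2 * |(partialY (M.f i) z).1|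
      ≤ α * |(partialX (M.f i) z).1|
  h2 : ∀ i, ∀ z ∈ M.E i,
    K₀ ≤ |(partialX (M.f i) z).1| - α * |(partialY (M.f i) z).1|
  h3 : ∀ i, ∀ z ∈ M.E i,
    |(partialY (M.f i) z).1| + α * |(partialY (M.f i) z).2| + α ^ 2 * |(partialX (M.f i) z).2|
      ≤ α * |(partialX (M.f i) z).1|
  h4 : ∀ i, ∀ z ∈ M.E i,
    absJacobian (M.f i) z * K₀ ≤ |(partialX (M.f i) z).1| - α * |(partialX (M.f i) z).2|

/-- Distortion condition D2 with constant `C₀`. -/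
def Distortion (M : HyperbolicModel ι) (C₀ : ℝ) : Prop :=
  ∀ i, ∀ z ∈ M.E i, secondDerivMax (M.f i) z / ‖partialX (M.f i) z‖ < C₀

/-! ## Symbolic description

A past `ξ : ℕ → ι` lists `ξ k = i_{-(k+1)}`; a future `x : ℕ → ι` lists `x k = i_k`; a two-sided
sequence is `ω : ℤ → ι`. The one-sided symbolic space `Ω₊` is `ℕ → ι`. -/

/-- `(i_{-1}, i_{-2}, …)`. -/
def past (ω : ℤ → ι) (k : ℕ) : ι := ω (-(k + 1 : ℤ))

/-- `(i_0, i_1, …)`. -/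
def future (ω : ℤ → ι) (k : ℕ) : ι := ω k

/-- The two-sided sequence with a given past and a given future. -/
def glue (ξ x : ℕ → ι) : ℤ → ι
  | Int.ofNat k => x k
  | Int.negSucc k => ξ k

/-- The left shift on two-sided sequences. -/
def shift (ω : ℤ → ι) : ℤ → ι := fun k => ω (k + 1)

/-- `E_{i_0 … i_{n-1}} = E_{i_0} ∩ f_{i_0}⁻¹ E_{i_1 … i_{n-1}}`; it is `Q` for `n = 0`. -/
def cylinderE (M : HyperbolicModel ι) : ℕ → (ℕ → ι) → Set (ℝ × ℝ)
  | 0, _ => unitSquare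
  | n + 1, x => M.E (x 0) ∩ M.f (x 0) ⁻¹' cylinderE M n (fun k => x (k + 1))

/-- `S_{i_{-m} … i_{-1}} = f_{i_{-1}} (S_{i_{-m} … i_{-2}} ∩ E_{i_{-1}})`; it is `Q` for `m = 0`. -/
def cylinderS (M : HyperbolicModel ι) : ℕ → (ℕ → ι) → Set (ℝ × ℝ)
  | 0, _ => unitSquare
  | m + 1, ξ => M.f (ξ 0) '' (cylinderS M m (fun k => ξ (k + 1)) ∩ M.E (ξ 0))

/-- The stable manifold given by a future. -/
def stableSet (M : HyperbolicModel ι) (x : ℕ → ι) : Set (ℝ × ℝ) := ⋂ n, M.cylinderE n x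

/-- The unstable manifold given by a past. -/
def unstableSet (M : HyperbolicModel ι) (ξ : ℕ → ι) : Set (ℝ × ℝ) := ⋂ m, M.cylinderS m ξ

/-- The point of the attractor coded by `ω`, i.e. the (unique) point of intersection of the
stable manifold of its future and the unstable manifold of its past. -/
def point (M : HyperbolicModel ι) (ω : ℤ → ι) : ℝ × ℝ :=
  Classical.epsilon fun z => z ∈ M.stableSet (future ω) ∩ M.unstableSet (past ω)

/-- The function `y(x)` whose graph is the unstable manifold: `unstableFun ξ x` is the (unique)
`y` with `(x, y)` in the unstable manifold. -/
def unstableFun (M : HyperbolicModel ι) (ξ : ℕ → ι) (x : ℝ) : ℝ :=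
  sSup {y | (x, y) ∈ M.unstableSet ξ}

/-- Slope at the point coded by `ω` of its unstable manifold. -/
def unstableSlope (M : HyperbolicModel ι) (ω : ℤ → ι) : ℝ :=
  derivWithin (M.unstableFun (past ω)) (Icc 0 1) (M.point ω).1

/-- `DᵘF`: norm of the image under the differential of `F` of the tangent vector `(1, a)` to the
unstable manifold. It is a unit vector of the max norm, since `|a| ≤ α < 1`. -/
def unstableDeriv (M : HyperbolicModel ι) (ω : ℤ → ι) : ℝ :=
  ‖fderiv ℝ (M.f (ω 0)) (M.point ω) (1, M.unstableSlope ω)‖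

/-- `φ = - log DᵘF`. -/
def phi (M : HyperbolicModel ι) (ω : ℤ → ι) : ℝ := -Real.log (M.unstableDeriv ω)

/-- The `k`-th term `φ(Fᵏ z) - φ(Fᵏ z₀)`, where `z` is coded by `ω` and `z₀` is the point where the
stable manifold of `z` meets the fixed unstable manifold, the one with past `η`. -/
def uTerm (M : HyperbolicModel ι) (η : ℕ → ι) (k : ℕ) (ω : ℤ → ι) : ℝ :=
  M.phi (shift^[k] ω) - M.phi (shift^[k] (glue η (future ω)))

/-- `u(z) = ∑_{k ≥ 0} (φ(Fᵏ z) - φ(Fᵏ z₀))`. -/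
def u (M : HyperbolicModel ι) (η : ℕ → ι) (ω : ℤ → ι) : ℝ := ∑' k, M.uTerm η k ω

/-- `ψ(z) = φ(z) - u(z) + u(F z)`. -/
def psi (M : HyperbolicModel ι) (η : ℕ → ι) (ω : ℤ → ι) : ℝ :=
  M.phi ω - M.u η ω + M.u η (shift ω)

/-- `φᵘ`: the function `ψ`, which depends only on the future, as a function on `Ω₊`. -/
def phiU (M : HyperbolicModel ι) (η : ℕ → ι) (x : ℕ → ι) : ℝ := M.psi η (glue η x)

/-- `V_n(g) = sup {|g x - g y| : x_i = y_i for i = 0, …, n - 1}`, with values in `[0, ∞]`. -/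
def variation (g : (ℕ → ι) → ℝ) (n : ℕ) : ENNReal :=
  ⨆ (x : ℕ → ι) (y : ℕ → ι) (_ : ∀ i < n, x i = y i), ENNReal.ofReal |g x - g y|

/-- Local Hölder property on `Ω₊`: `V_n(g) < C θⁿ` for all `n ≥ 1`. -/
def LocallyHolder (g : (ℕ → ι) → ℝ) : Prop :=
  ∃ C θ : ℝ, 0 < C ∧ 0 < θ ∧ θ < 1 ∧
    ∀ n : ℕ, 1 ≤ n → variation g n < ENNReal.ofReal (C * θ ^ n)

end HyperbolicModel

end

noncomputable section

namespace HyperbolicModel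

variable {ι : Type*}

/-! ## One variable calculus -/

/-! Cones carry the geometry. H1 and H2 say that `Df_i` maps the horizontal cone |dy| ≤ α|dx| into
itself and expands it; H3 and H4 say the same of the inverse and the vertical cone. `HypRel` records
the finite-scale form of this, together with the fact that a horizontal graph is stretched across
the whole square. This notion is stable under composition and time reversal, so n-step itineraries
expand by K₀ⁿ. Cylinders then shrink to Lipschitz graphs (`SCone_of_forall_hypRel`), and a stable
and an unstable graph meet exactly once (`eq_point`).

Tangent slopes of unstable manifolds are transported by the Möbius maps `slopeMap`, which contract
by `slopeRate` = 1/(K₀²(1-α²)), less than 1 by H5. Applied to chords of graphs arbitrarily far in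
the past, this turns the Lipschitz bound into C¹ regularity (`slopeNear_image`, `exists_slopeNear`).
D2 makes the slope maps and the logarithmic expansion Lipschitz in the base point, with one constant
for all i.

Two exponential estimates for φ follow. For equal futures, the values along the two orbits approach
each other (`abs_phi_iterate_sub_le`), so u converges uniformly, and a telescoping sum shows that ψ
forgets the past (`psi_eq_phiU`). For equal pasts and n common future symbols, the values of φ
differ by O(K₀⁻ⁿ) (`abs_phi_sub_le_of_past_eq`). In the series for φᵘ(x) - φᵘ(y) the second estimate
controls the terms with k < n/2 and the first one the others (`locallyHolder_phiU`). -/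

lemma norm_sub_le_of_pointwise {V : Type*} [NormedAddCommGroup V] {g : ℝ → V} {C a b : ℝ}
    (hg : ContinuousOn g (Icc a b))
    (h : ∀ x ∈ Icc a b, ∀ ε > 0, ∀ᶠ y in 𝓝[Icc a b] x, ‖g y - g x‖ ≤ (C + ε) * |y - x|)
    {x y : ℝ} (hx : x ∈ Icc a b) (hy : y ∈ Icc a b) (hxy : x ≤ y) :
    ‖g y - g x‖ ≤ C * (y - x) := by
  have key : ∀ ε > 0, ‖g y - g x‖ ≤ (C + ε) * (y - x) := by
    intro ε hε
    have hsub : Icc x y ⊆ Icc a b := Icc_subset_Icc hx.1 hy.2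
    -- Continuous induction: the bound holds on a closed set of t, and the local hypothesis at such
    -- a t extends it to some s > t. Differentiability of g is not needed, which matters for the
    -- sides of `E_i` and for stable manifolds.
    have hclosed : IsClosed ({t | ‖g t - g x‖ ≤ (C + ε) * (t - x)} ∩ Icc x y) := by
      have := IsClosed.isClosed_le (s := Icc x y) (f := fun t => ‖g t - g x‖)
        (g := fun t => (C + ε) * (t - x)) isClosed_Icc
        (((hg.mono hsub).sub continuousOn_const).norm) (by fun_prop)
      convert this using 1
      ext t; simp [and_comm]
    refine hclosed.mem_of_ge_of_forall_exists_gt (by simp) hxy ?_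
    rintro t ⟨ht, htxy⟩
    have hta : t ∈ Icc a b := hsub (Ico_subset_Icc_self htxy)
    have hioc : Ioc t y ⊆ Icc a b := fun s hs => ⟨hta.1.trans hs.1.le, hs.2.trans hy.2⟩
    have h1 := (h t hta ε hε).filter_mono (nhdsWithin_mono t hioc)
    have hne : (𝓝[Ioc t y] t).NeBot := by
      rw [nhdsWithin_Ioc_eq_nhdsGT htxy.2]; infer_instance
    obtain ⟨s, hs, hs'⟩ := (h1.and self_mem_nhdsWithin).exists
    refine ⟨s, ?_, hs'⟩
    have h2 : ‖g s - g x‖ ≤ ‖g s - g t‖ + ‖g t - g x‖ := norm_sub_le_norm_sub_add_norm_sub _ _ _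
    rw [abs_of_pos (sub_pos.2 hs'.1)] at hs
    simp only [mem_ofPred_eq] at ht ⊢
    linarith
  refine le_of_forall_pos_le_add fun ε hε => ?_
  have hd : 0 < y - x + 1 := by linarith
  have := key (ε / (y - x + 1)) (by positivity)
  have h3 : ε / (y - x + 1) * (y - x) ≤ ε := by
    rw [div_mul_eq_mul_div, div_le_iff₀ hd]; nlinarith
  linarith

lemma norm_sub_le_of_pointwise' {V : Type*} [NormedAddCommGroup V] {g : ℝ → V} {C a b : ℝ}
    (hg : ContinuousOn g (Icc a b))
    (h : ∀ x ∈ Icc a b, ∀ ε > 0, ∀ᶠ y in 𝓝[Icc a b] x, ‖g y - g x‖ ≤ (C + ε) * |y - x|)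
    {x y : ℝ} (hx : x ∈ Icc a b) (hy : y ∈ Icc a b) :
    ‖g x - g y‖ ≤ C * |x - y| := by
  rcases le_total x y with hxy | hxy
  · rw [norm_sub_rev, abs_sub_comm, abs_of_nonneg (sub_nonneg.2 hxy)]
    exact norm_sub_le_of_pointwise hg h hx hy hxy
  · rw [abs_of_nonneg (sub_nonneg.2 hxy)]
    exact norm_sub_le_of_pointwise hg h hy hx hxy

/-- A plane curve with velocity in a cone has its chord in the cone. -/
lemma chord_mem_cone {c d c' d' : ℝ → ℝ} {α k : ℝ} (hk : 0 < k)
    (hc : ∀ t ∈ Icc (0 : ℝ) 1, HasDerivWithinAt c (c' t) (Icc 0 1) t)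
    (hd : ∀ t ∈ Icc (0 : ℝ) 1, HasDerivWithinAt d (d' t) (Icc 0 1) t)
    (hcone : ∀ t ∈ Icc (0 : ℝ) 1, |d' t| ≤ α * |c' t|)
    (hexp : ∀ t ∈ Icc (0 : ℝ) 1, k ≤ |c' t|) :
    |d 1 - d 0| ≤ α * |c 1 - c 0| ∧ k ≤ |c 1 - c 0| := by
  have hcc : ContinuousOn c (Icc 0 1) := fun t ht => (hc t ht).continuousWithinAt
  have hdc : ContinuousOn d (Icc 0 1) := fun t ht => (hd t ht).continuousWithinAt
  have hc' : ∀ t ∈ Ioo (0 : ℝ) 1, HasDerivAt c (c' t) t := fun t ht =>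
    (hc t (Ioo_subset_Icc_self ht)).hasDerivAt (Icc_mem_nhds ht.1 ht.2)
  have hd' : ∀ t ∈ Ioo (0 : ℝ) 1, HasDerivAt d (d' t) t := fun t ht =>
    (hd t (Ioo_subset_Icc_self ht)).hasDerivAt (Icc_mem_nhds ht.1 ht.2)
  constructor
  -- Cauchy's mean value theorem treats both coordinates at one common time t, where the velocity is
  -- parallel to the chord.
  · obtain ⟨t, ht, h⟩ := exists_ratio_hasDerivAt_eq_ratio_slope c c' one_pos hcc hc' d d' hdc hd'
    have ht' := Ioo_subset_Icc_self ht
    have h1 := hcone t ht'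
    have h2 := hexp t ht'
    have h3 : |d 1 - d 0| * |c' t| = |c 1 - c 0| * |d' t| := by rw [← abs_mul, ← abs_mul, h]
    have h4 : |d 1 - d 0| * |c' t| ≤ (α * |c 1 - c 0|) * |c' t| := by
      rw [h3]; nlinarith [abs_nonneg (c 1 - c 0)]
    exact le_of_mul_le_mul_right h4 (hk.trans_le h2)
  · obtain ⟨t, ht, h⟩ := exists_hasDerivAt_eq_slope c c' one_pos hcc hc'
    have h2 := hexp t (Ioo_subset_Icc_self ht)
    rw [h] at h2; simpa using h2

/-! ## Cones and Lipschitz graphs -/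

/-- `z` and `w` differ by a vector in the unstable cone. -/
def UCone (α : ℝ) (z w : ℝ × ℝ) : Prop := |z.2 - w.2| ≤ α * |z.1 - w.1|

/-- `z` and `w` differ by a vector in the stable cone. -/
def SCone (α : ℝ) (z w : ℝ × ℝ) : Prop := |z.1 - w.1| ≤ α * |z.2 - w.2|

lemma eq_of_UCone_of_SCone {α : ℝ} (hα1 : α < 1) {z w : ℝ × ℝ}
    (hu : UCone α z w) (hs : SCone α z w) : z = w := by
  unfold UCone SCone at *
  have h1 : |z.1 - w.1| = 0 := by
    by_contra hne
    have : 0 < |z.1 - w.1| := lt_of_le_of_ne (abs_nonneg _) (Ne.symm hne)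
    nlinarith [abs_nonneg (z.2 - w.2)]
  have h2 : |z.2 - w.2| = 0 := by
    rw [h1] at hu; exact le_antisymm (by simpa using hu) (abs_nonneg _)
  exact Prod.ext (sub_eq_zero.1 (abs_eq_zero.1 h1)) (sub_eq_zero.1 (abs_eq_zero.1 h2))

lemma norm_sub_eq_of_UCone {α : ℝ} (hα1 : α < 1) {z w : ℝ × ℝ} (hu : UCone α z w) :
    ‖z - w‖ = |z.1 - w.1| := by
  unfold UCone at hu
  rw [Prod.norm_def]
  refine max_eq_left ?_
  simp only [Prod.fst_sub, Prod.snd_sub, Real.norm_eq_abs]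
  nlinarith [abs_nonneg (z.1 - w.1)]

lemma norm_sub_eq_of_SCone {α : ℝ} (hα1 : α < 1) {z w : ℝ × ℝ} (hs : SCone α z w) :
    ‖z - w‖ = |z.2 - w.2| := by
  unfold SCone at hs
  rw [Prod.norm_def]
  refine max_eq_right ?_
  simp only [Prod.fst_sub, Prod.snd_sub, Real.norm_eq_abs]
  nlinarith [abs_nonneg (z.2 - w.2)]

/-- Lipschitz functions from the unit interval to itself. -/
structure LipGraph (α : ℝ) (g : ℝ → ℝ) : Prop where
  mapsTo : MapsTo g (Icc 0 1) (Icc 0 1)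
  lip : ∀ s ∈ Icc (0 : ℝ) 1, ∀ t ∈ Icc (0 : ℝ) 1, |g s - g t| ≤ α * |s - t|

lemma continuousOn_of_lip {g : ℝ → ℝ} {C : ℝ} {s : Set ℝ}
    (h : ∀ x ∈ s, ∀ y ∈ s, |g x - g y| ≤ C * |x - y|) : ContinuousOn g s := by
  have : LipschitzOnWith (Real.toNNReal C) g s := by
    refine LipschitzOnWith.of_dist_le_mul fun x hx y hy => ?_
    rw [Real.dist_eq, Real.dist_eq]
    exact (h x hx y hy).trans
      (mul_le_mul_of_nonneg_right (Real.le_coe_toNNReal C) (abs_nonneg _))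
  exact this.continuousOn

lemma LipGraph.continuousOn {α : ℝ} {g : ℝ → ℝ} (h : LipGraph α g) :
    ContinuousOn g (Icc 0 1) := continuousOn_of_lip h.lip

lemma lipGraph_const {α c : ℝ} (hα : 0 ≤ α) (hc : c ∈ Icc (0 : ℝ) 1) :
    LipGraph α fun _ => c :=
  ⟨fun _ _ => hc, fun s _ t _ => by simpa using mul_nonneg hα (abs_nonneg _)⟩

/-- A horizontal and a vertical graph meet. -/
lemma LipGraph.exists_cross {α : ℝ} {g h : ℝ → ℝ} (hg : LipGraph α g) (hh : LipGraph α h) :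
    ∃ x ∈ Icc (0 : ℝ) 1, h (g x) = x := by
  have hc : ContinuousOn (fun x => h (g x) - x) (Icc 0 1) :=
    (hh.continuousOn.comp hg.continuousOn hg.mapsTo).sub continuousOn_id
  have h0 := (hh.mapsTo (hg.mapsTo (left_mem_Icc.2 (zero_le_one' ℝ)))).1
  have h1 := (hh.mapsTo (hg.mapsTo (right_mem_Icc.2 (zero_le_one' ℝ)))).2
  obtain ⟨x, hx, hx'⟩ := intermediate_value_Icc' (zero_le_one' ℝ) hc
    (show (0 : ℝ) ∈ Icc _ _ from ⟨by simpa using h1, by simpa using h0⟩)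
  exact ⟨x, hx, sub_eq_zero.1 hx'⟩

/-! ## Hyperbolic relations -/

/-- A relation on the unit square which behaves like a hyperbolic map from a full height
rectangle onto a full width strip, with expansion constant `K`. -/
structure HypRel (α K : ℝ) (R : ℝ × ℝ → ℝ × ℝ → Prop) : Prop where
  dom : ∀ {z z'}, R z z' → z ∈ unitSquare ∧ z' ∈ unitSquare
  unst : ∀ {z z' w w'}, R z z' → R w w' → UCone α z w →
    UCone α z' w' ∧ K * |z.1 - w.1| ≤ |z'.1 - w'.1|
  stab : ∀ {z z' w w'}, R z z' → R w w' → SCone α z' w' →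
    SCone α z w ∧ K * |z'.2 - w'.2| ≤ |z.2 - w.2|
  full : ∀ {g h}, LipGraph α g → LipGraph α h →
    ∃ z z', R z z' ∧ z.2 = g z.1 ∧ z'.1 = h z'.2

lemma swap_mem_unitSquare {z : ℝ × ℝ} : z.swap ∈ unitSquare ↔ z ∈ unitSquare := by
  simp only [unitSquare, mem_prod, Prod.fst_swap, Prod.snd_swap]; tauto

/-- Time reversal combined with exchange of the coordinates. It makes each result on stable sets
yield its unstable twin. -/
lemma HypRel.swap {α K : ℝ} {R : ℝ × ℝ → ℝ × ℝ → Prop} (h : HypRel α K R) :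
    HypRel α K fun z z' => R z'.swap z.swap where
  dom hz := ⟨swap_mem_unitSquare.1 (h.dom hz).2, swap_mem_unitSquare.1 (h.dom hz).1⟩
  unst hz hw hu := h.stab hz hw hu
  stab hz hw hu := h.unst hz hw hu
  full {g k} hg hk := by
    obtain ⟨z, z', hR, h1, h2⟩ := h.full hk hg
    exact ⟨z'.swap, z.swap, by simpa using hR, h2, h1⟩

lemma hypRel_id {α : ℝ} : HypRel α 1 fun z z' => z = z' ∧ z ∈ unitSquare where
  dom := by rintro z _ ⟨rfl, h⟩; exact ⟨h, h⟩
  unst := by rintro z _ w _ ⟨rfl, -⟩ ⟨rfl, -⟩ h; exact ⟨h, by simp⟩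
  stab := by rintro z _ w _ ⟨rfl, -⟩ ⟨rfl, -⟩ h; exact ⟨h, by simp⟩
  full {g h} hg hh := by
    obtain ⟨x, hx, hx'⟩ := hg.exists_cross hh
    exact ⟨(x, g x), (x, g x), ⟨rfl, hx, hg.mapsTo hx⟩, rfl, hx'.symm⟩

/-- The image of a horizontal graph under a hyperbolic relation is a horizontal graph. -/
lemma HypRel.exists_graph {α K : ℝ} {R : ℝ × ℝ → ℝ × ℝ → Prop} (hα : 0 ≤ α) (h : HypRel α K R)
    {g : ℝ → ℝ} (hg : LipGraph α g) :
    ∃ G, LipGraph α G ∧ ∀ x ∈ Icc (0 : ℝ) 1, ∃ z, R z (x, G x) ∧ z.2 = g z.1 := by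
  -- The vertical line over x serves as the vertical graph in `full`.
  have key : ∀ x ∈ Icc (0 : ℝ) 1, ∃ y z, R z (x, y) ∧ z.2 = g z.1 := by
    intro x hx
    obtain ⟨z, z', hR, h1, h2⟩ := h.full hg (lipGraph_const hα hx)
    refine ⟨z'.2, z, ?_, h1⟩
    have : z' = (x, z'.2) := Prod.ext h2 rfl
    rwa [this] at hR
  choose! G z hG using key
  refine ⟨G, ⟨fun x hx => (h.dom (hG x hx).1).2.2, fun s hs t ht => ?_⟩,
    fun x hx => ⟨z x, hG x hx⟩⟩
  have hu : UCone α (z s) (z t) := by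
    unfold UCone
    rw [(hG s hs).2, (hG t ht).2]
    exact hg.lip _ (h.dom (hG s hs).1).1.1 _ (h.dom (hG t ht).1).1.1
  exact (h.unst (hG s hs).1 (hG t ht).1 hu).1

lemma HypRel.comp {α K L : ℝ} {R T : ℝ × ℝ → ℝ × ℝ → Prop} (hα : 0 ≤ α) (hK : 0 ≤ K)
    (hL : 0 ≤ L) (hR : HypRel α K R) (hT : HypRel α L T) :
    HypRel α (K * L) fun z z'' => ∃ z', R z z' ∧ T z' z'' where
  dom := by
    rintro z z'' ⟨z', h1, h2⟩
    exact ⟨(hR.dom h1).1, (hT.dom h2).2⟩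
  unst := by
    rintro z z'' w w'' ⟨z', h1, h2⟩ ⟨w', h3, h4⟩ hu
    obtain ⟨hu', hk⟩ := hR.unst h1 h3 hu
    obtain ⟨hu'', hl⟩ := hT.unst h2 h4 hu'
    refine ⟨hu'', le_trans ?_ hl⟩
    rw [mul_comm K, mul_assoc]
    exact mul_le_mul_of_nonneg_left hk hL
  stab := by
    rintro z z'' w w'' ⟨z', h1, h2⟩ ⟨w', h3, h4⟩ hs
    obtain ⟨hs', hl⟩ := hT.stab h2 h4 hs
    obtain ⟨hs'', hk⟩ := hR.stab h1 h3 hs'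
    refine ⟨hs'', le_trans ?_ hk⟩
    rw [mul_assoc]
    exact mul_le_mul_of_nonneg_left hl hK
  full {g h} hg hh := by
    -- Push g forward to a horizontal graph G, cross G with h by means of T, and pull the crossing
    -- point back through R.
    obtain ⟨G, hG, hG'⟩ := hR.exists_graph hα hg
    obtain ⟨z', z'', h1, h2, h3⟩ := hT.full hG hh
    obtain ⟨z, hz, hz'⟩ := hG' z'.1 (hT.dom h1).1.1
    refine ⟨z, z'', ⟨z', ?_, h1⟩, hz', h3⟩
    have : z' = (z'.1, G z'.1) := Prod.ext rfl h2
    rwa [this]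

/-- Points in the domains of hyperbolic relations of arbitrarily large expansion differ by a vector
in the stable cone. -/
lemma SCone_of_forall_hypRel {α K : ℝ} (hα : 0 ≤ α) (hK : 1 < K)
    {R : ℕ → ℝ × ℝ → ℝ × ℝ → Prop} (h : ∀ n, HypRel α (K ^ n) (R n)) {z w : ℝ × ℝ}
    (hz : ∀ n, ∃ z', R n z z') (hw : ∀ n, ∃ w', R n w w') : SCone α z w := by
  have key : ∀ n, |z.1 - w.1| ≤ α * |z.2 - w.2| + (1 / K) ^ n := by
    intro n
    obtain ⟨z', hz'⟩ := hz n
    obtain ⟨w', hw'⟩ := hw n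
    have hwQ := (h n).dom hw'
    have hzQ := (h n).dom hz'
    -- The auxiliary point p has the height of w, and its image lies on the vertical line through
    -- z'. Hence z and p differ by a stable vector, while p and w differ by a horizontal one, of
    -- length at most K⁻ⁿ since its image fits in the square.
    obtain ⟨p, p', hp, h1, h2⟩ := (h n).full (lipGraph_const hα hwQ.1.2)
      (lipGraph_const hα hzQ.2.1)
    have hs : SCone α z p := ((h n).stab hz' hp (by
      unfold SCone; rw [h2]; simpa using mul_nonneg hα (abs_nonneg _))).1
    have hu := ((h n).unst hp hw' (by
      unfold UCone; rw [h1]; simpa using mul_nonneg hα (abs_nonneg _))).2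
    unfold SCone at hs
    rw [h1] at hs
    have hpQ := (h n).dom hp
    have h3 : |p'.1 - w'.1| ≤ 1 :=
      abs_le.2 ⟨by linarith [hpQ.2.1.1, hwQ.2.1.2], by linarith [hpQ.2.1.2, hwQ.2.1.1]⟩
    have hKn : 0 < K ^ n := by positivity
    have h4 : |p.1 - w.1| ≤ (1 / K) ^ n := by
      rw [one_div, inv_pow, ← one_div, le_div_iff₀ hKn]; linarith
    linarith [abs_sub_le z.1 p.1 w.1]
  have hlim : Tendsto (fun n : ℕ => α * |z.2 - w.2| + (1 / K) ^ n) atTop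
      (𝓝 (α * |z.2 - w.2| + 0)) :=
    tendsto_const_nhds.add (tendsto_pow_atTop_nhds_zero_of_lt_one (by positivity)
      (by rw [div_lt_one (by linarith)]; exact hK))
  rw [add_zero] at hlim
  exact ge_of_tendsto' hlim key

lemma UCone_of_forall_hypRel {α K : ℝ} (hα : 0 ≤ α) (hK : 1 < K)
    {R : ℕ → ℝ × ℝ → ℝ × ℝ → Prop} (h : ∀ n, HypRel α (K ^ n) (R n)) {z w : ℝ × ℝ}
    (hz : ∀ n, ∃ z', R n z' z) (hw : ∀ n, ∃ w', R n w' w) : UCone α z w :=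
  SCone_of_forall_hypRel hα hK (R := fun n z z' => R n z'.swap z.swap) (fun n => (h n).swap)
    (z := z.swap) (w := w.swap)
    (fun n => (hz n).imp' Prod.swap fun _ => by simp)
    (fun n => (hw n).imp' Prod.swap fun _ => by simp)

/-! ## The maps `f_i` on the rectangles `E_i` -/

lemma fderiv_apply_eq (g : ℝ × ℝ → ℝ × ℝ) (z v : ℝ × ℝ) :
    fderiv ℝ g z v = v.1 • partialX g z + v.2 • partialY g z := by
  unfold partialX partialY
  rw [← map_smul, ← map_smul, ← map_add]
  congr 1
  ext <;> simp

lemma contDiffAt_f (M : HyperbolicModel ι) {i : ι} {z : ℝ × ℝ} (hz : z ∈ M.E i) :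
    ContDiffAt ℝ 2 (M.f i) z :=
  (M.contDiffOn_f i).contDiffAt ((M.f i).open_source.mem_nhds (M.subset_source i hz))

lemma hasFDerivAt_f (M : HyperbolicModel ι) {i : ι} {z : ℝ × ℝ} (hz : z ∈ M.E i) :
    HasFDerivAt (M.f i) (fderiv ℝ (M.f i) z) z :=
  ((M.contDiffAt_f hz).differentiableAt (by norm_num)).hasFDerivAt

lemma continuousOn_f (M : HyperbolicModel ι) (i : ι) : ContinuousOn (M.f i) (M.E i) :=
  (M.f i).continuousOn.mono (M.subset_source i)

lemma injOn_f (M : HyperbolicModel ι) (i : ι) : InjOn (M.f i) (M.E i) :=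
  (M.f i).injOn.mono (M.subset_source i)

lemma E_subset (M : HyperbolicModel ι) (i : ι) : M.E i ⊆ unitSquare := fun _ hz =>
  ⟨⟨(M.left_nonneg i _ hz.1).trans hz.2.1, hz.2.2.trans (M.right_le_one i _ hz.1)⟩, hz.1⟩

/-- A continuous vertical curve mapped into the vertical sides of the square is
`α`-Lipschitz. -/
lemma lip_of_lateral (M : HyperbolicModel ι) {α K₀ : ℝ} (hα0 : 0 < α) (hα1 : α < 1)
    (hK : 1 < K₀) (hH : M.Hyperbolic α K₀) (i : ι) {q : ℝ → ℝ} (hq : ContinuousOn q (Icc 0 1))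
    (hE : ∀ y ∈ Icc (0 : ℝ) 1, (q y, y) ∈ M.E i)
    (h01 : ∀ y ∈ Icc (0 : ℝ) 1, (M.f i (q y, y)).1 = 0 ∨ (M.f i (q y, y)).1 = 1) :
    ∀ x ∈ Icc (0 : ℝ) 1, ∀ y ∈ Icc (0 : ℝ) 1, |q x - q y| ≤ α * |x - y| := by
  intro x hx y hy
  refine norm_sub_le_of_pointwise' hq (fun y₀ hy₀ ε hε => ?_) hx hy
  have hp := hE y₀ hy₀
  have hcurve : ContinuousWithinAt (fun y => (q y, y)) (Icc 0 1) y₀ :=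
    (hq y₀ hy₀).prodMk continuousWithinAt_id
  have htend : Tendsto (fun y => (q y, y)) (𝓝[Icc 0 1] y₀) (𝓝 (q y₀, y₀)) := hcurve
  have hcont : Tendsto (fun y => (M.f i (q y, y)).1) (𝓝[Icc 0 1] y₀)
      (𝓝 (M.f i (q y₀, y₀)).1) :=
    (continuous_fst.tendsto _).comp ((M.hasFDerivAt_f hp).continuousAt.tendsto.comp htend)
  -- F₁ takes only the values 0 and 1 along the curve, so continuity makes it locally constant. The
  -- curve follows a level set of F₁, and H3 bounds |F₁ᵧ| by α|F₁ₓ|.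
  have hconst : ∀ᶠ y in 𝓝[Icc 0 1] y₀, (M.f i (q y, y)).1 = (M.f i (q y₀, y₀)).1 := by
    filter_upwards [hcont (Metric.ball_mem_nhds _ one_pos), self_mem_nhdsWithin] with y h1 hy
    have h1 : |(M.f i (q y, y)).1 - (M.f i (q y₀, y₀)).1| < 1 := h1
    rcases h01 y hy with h | h <;> rcases h01 y₀ hy₀ with h' | h' <;> rw [h, h'] at h1 ⊢ <;>
      norm_num at h1
  -- Chosen so that α + e ≤ (1 - e)(α + ε): the linearization error e(A + B) is absorbed into the
  -- slack ε.
  set e := ε / (2 + ε) with he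
  have hε2 : 0 < 2 + ε := by linarith
  have he0 : 0 < e := by positivity
  have hee : e * (2 + ε) = ε := div_mul_cancel₀ _ hε2.ne'
  have hlittle := htend.eventually ((M.hasFDerivAt_f hp).isLittleO.def he0)
  filter_upwards [hconst, hlittle] with y h1 h2
  rw [fderiv_apply_eq] at h2
  have h3 := (norm_fst_le _).trans h2
  rw [Prod.norm_def] at h3
  simp only [Prod.fst_sub, Prod.snd_sub, Prod.fst_add, Prod.smul_fst, smul_eq_mul, h1, sub_self,
    zero_sub, norm_neg, Real.norm_eq_abs] at h3 ⊢
  have hX := hH.h2 i _ hp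
  have hY := hH.h3 i _ hp
  set X := (partialX (M.f i) (q y₀, y₀)).1
  set Y := (partialY (M.f i) (q y₀, y₀)).1
  set A := |q y - q y₀|
  set B := |y - y₀|
  have hA : 0 ≤ A := abs_nonneg _
  have hB : 0 ≤ B := abs_nonneg _
  have hmax : max A B ≤ A + B := max_le (by linarith) (by linarith)
  have h4 : A * |X| ≤ B * |Y| + e * (A + B) := by
    have h5 : |(q y - q y₀) * X| ≤ |(q y - q y₀) * X + (y - y₀) * Y| + |(y - y₀) * Y| := by
      have := abs_sub ((q y - q y₀) * X + (y - y₀) * Y) ((y - y₀) * Y)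
      rwa [add_sub_cancel_right] at this
    rw [abs_mul, abs_mul (y - y₀)] at h5
    nlinarith
  have hY' : |Y| ≤ α * |X| := by
    have h6 : 0 ≤ α * |(partialY (M.f i) (q y₀, y₀)).2| := by positivity
    have h7 : 0 ≤ α ^ 2 * |(partialX (M.f i) (q y₀, y₀)).2| := by positivity
    linarith
  have hX1 : 1 ≤ |X| := by
    have : 0 ≤ α * |Y| := by positivity
    linarith
  have h8 : A * |X| ≤ (B * α + e * (A + B)) * |X| := by
    have h9 : B * |Y| ≤ B * (α * |X|) := mul_le_mul_of_nonneg_left hY' hB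
    have h10 : e * (A + B) ≤ e * (A + B) * |X| := le_mul_of_one_le_right (by positivity) hX1
    linarith
  have h11 : A ≤ B * α + e * (A + B) := le_of_mul_le_mul_right h8 (by linarith)
  have h12 : (1 - e) * A ≤ (1 - e) * ((α + ε) * B) := by
    have : e * (1 + α + ε) ≤ ε := by nlinarith
    nlinarith
  have he1 : e < 1 := by rw [he, div_lt_one hε2]; linarith
  exact le_of_mul_le_mul_left h12 (by linarith)

lemma lipGraph_left (M : HyperbolicModel ι) {α K₀ : ℝ} (hα0 : 0 < α) (hα1 : α < 1)
    (hK : 1 < K₀) (hH : M.Hyperbolic α K₀) (i : ι) : LipGraph α (M.left i) where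
  mapsTo y hy := ⟨M.left_nonneg i y hy, (M.left_lt_right i y hy).le.trans (M.right_le_one i y hy)⟩
  lip := M.lip_of_lateral hα0 hα1 hK hH i (M.continuousOn_left i)
    (fun y hy => ⟨hy, le_rfl, (M.left_lt_right i y hy).le⟩) (M.f_left i)

lemma lipGraph_right (M : HyperbolicModel ι) {α K₀ : ℝ} (hα0 : 0 < α) (hα1 : α < 1)
    (hK : 1 < K₀) (hH : M.Hyperbolic α K₀) (i : ι) : LipGraph α (M.right i) where
  mapsTo y hy := ⟨(M.left_nonneg i y hy).trans (M.left_lt_right i y hy).le, M.right_le_one i y hy⟩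
  lip := M.lip_of_lateral hα0 hα1 hK hH i (M.continuousOn_right i)
    (fun y hy => ⟨hy, (M.left_lt_right i y hy).le, le_rfl⟩) (M.f_right i)

/-! ### Segments in strips and the cone conditions at finite scale. -/

/-- The full height region between two vertical graphs. -/
def strip (l r : ℝ → ℝ) : Set (ℝ × ℝ) := {z | z.2 ∈ Icc (0 : ℝ) 1 ∧ l z.2 ≤ z.1 ∧ z.1 ≤ r z.2}

/-- The segment from `z` to `w`. -/
def seg (z w : ℝ × ℝ) (t : ℝ) : ℝ × ℝ := z + t • (w - z)

/-- Along a segment in the unstable cone the abscissa moves at least as fast as the boundary graphs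
can. The left boundary is compared with the left endpoint, the right boundary with the right
endpoint. -/
lemma seg_mem_strip {α : ℝ} (hα0 : 0 < α) (hα1 : α < 1) {l r : ℝ → ℝ} (hl : LipGraph α l)
    (hr : LipGraph α r) {z w : ℝ × ℝ} (hz : z ∈ strip l r) (hw : w ∈ strip l r)
    (hu : UCone α z w) {t : ℝ} (ht : t ∈ Icc (0 : ℝ) 1) : seg z w t ∈ strip l r := by
  obtain ⟨ht0, ht1⟩ := ht
  obtain ⟨hz2, hzl, hzr⟩ := hz
  obtain ⟨hw2, hwl, hwr⟩ := hw
  unfold UCone at hu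
  have hp1 : (seg z w t).1 = z.1 + t * (w.1 - z.1) := by simp [seg]
  have hp2 : (seg z w t).2 = z.2 + t * (w.2 - z.2) := by simp [seg]
  have hpI : (seg z w t).2 ∈ Icc (0 : ℝ) 1 := by
    rw [hp2]
    exact ⟨by nlinarith [hz2.1, hw2.1], by nlinarith [hz2.2, hw2.2]⟩
  have hd1 : |(seg z w t).2 - z.2| = t * |z.2 - w.2| := by
    rw [hp2, add_sub_cancel_left, abs_mul, abs_of_nonneg ht0, abs_sub_comm]
  have hd2 : |(seg z w t).2 - w.2| = (1 - t) * |z.2 - w.2| := by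
    rw [hp2, show z.2 + t * (w.2 - z.2) - w.2 = (1 - t) * (z.2 - w.2) by ring, abs_mul,
      abs_of_nonneg (by linarith)]
  have hα2 : α * |z.2 - w.2| ≤ |z.1 - w.1| :=
    (mul_le_of_le_one_left (abs_nonneg _) hα1.le).trans
      (hu.trans (mul_le_of_le_one_left (abs_nonneg _) hα1.le))
  have e1 : α * (t * |z.2 - w.2|) ≤ t * |z.1 - w.1| := by nlinarith
  have e2 : α * ((1 - t) * |z.2 - w.2|) ≤ (1 - t) * |z.1 - w.1| := by nlinarith
  have l1 := abs_le.1 (hl.lip _ hpI _ hz2)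
  have l2 := abs_le.1 (hl.lip _ hpI _ hw2)
  have r1 := abs_le.1 (hr.lip _ hpI _ hz2)
  have r2 := abs_le.1 (hr.lip _ hpI _ hw2)
  rw [hd1] at l1 r1
  rw [hd2] at l2 r2
  refine ⟨hpI, ?_, ?_⟩
  all_goals
    rw [hp1]
    rcases le_total z.1 w.1 with h | h
    · rw [abs_of_nonpos (sub_nonpos.2 h)] at e1 e2; linarith [l1.2, l2.2, r1.1, r2.1]
    · rw [abs_of_nonneg (sub_nonneg.2 h)] at e1 e2; linarith [l1.2, l2.2, r1.1, r2.1]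

lemma seg_mem_E (M : HyperbolicModel ι) {α K₀ : ℝ} (hα0 : 0 < α) (hα1 : α < 1)
    (hK : 1 < K₀) (hH : M.Hyperbolic α K₀) {i : ι} {z w : ℝ × ℝ} (hz : z ∈ M.E i)
    (hw : w ∈ M.E i) (hu : UCone α z w) {t : ℝ} (ht : t ∈ Icc (0 : ℝ) 1) : seg z w t ∈ M.E i :=
  seg_mem_strip hα0 hα1 (M.lipGraph_left hα0 hα1 hK hH i) (M.lipGraph_right hα0 hα1 hK hH i)
    hz hw hu ht

lemma hasDerivAt_seg (z w : ℝ × ℝ) (t : ℝ) : HasDerivAt (seg z w) (w - z) t := by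
  have := ((hasDerivAt_id t).smul_const (w - z)).const_add z
  rw [one_smul] at this
  exact this

lemma hasDerivAt_fst_snd {γ : ℝ → ℝ × ℝ} {v : ℝ × ℝ} {t : ℝ} (h : HasDerivAt γ v t) :
    HasDerivAt (fun s => (γ s).1) v.1 t ∧ HasDerivAt (fun s => (γ s).2) v.2 t :=
  ⟨(hasFDerivAt_fst (𝕜 := ℝ) (p := γ t)).comp_hasDerivAt t h,
    (hasFDerivAt_snd (𝕜 := ℝ) (p := γ t)).comp_hasDerivAt t h⟩

/-- The differential preserves the unstable cone and expands it. -/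
lemma fderiv_UCone (M : HyperbolicModel ι) {α K₀ : ℝ} (hα0 : 0 < α)
    (hH : M.Hyperbolic α K₀) {i : ι} {z v : ℝ × ℝ} (hz : z ∈ M.E i)
    (hv : |v.2| ≤ α * |v.1|) :
    |(fderiv ℝ (M.f i) z v).2| ≤ α * |(fderiv ℝ (M.f i) z v).1| ∧
      K₀ * |v.1| ≤ |(fderiv ℝ (M.f i) z v).1| := by
  rw [fderiv_apply_eq]
  have h1 := hH.h1 i z hz
  have h2 := hH.h2 i z hz
  simp only [Prod.fst_add, Prod.snd_add, Prod.smul_fst, Prod.smul_snd, smul_eq_mul]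
  set a := (partialX (M.f i) z).1
  set b := (partialY (M.f i) z).1
  set c := (partialX (M.f i) z).2
  set d := (partialY (M.f i) z).2
  have e1 : |v.1| * (|a| - α * |b|) ≤ |v.1 * a + v.2 * b| := by
    have h3 := abs_sub (v.1 * a + v.2 * b) (v.2 * b)
    rw [add_sub_cancel_right, abs_mul, abs_mul] at h3
    nlinarith [abs_nonneg b, abs_nonneg v.1]
  have e2 : |v.1 * c + v.2 * d| ≤ |v.1| * (|c| + α * |d|) := by
    have h3 := abs_add_le (v.1 * c) (v.2 * d)
    rw [abs_mul, abs_mul] at h3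
    nlinarith [abs_nonneg d, abs_nonneg v.1]
  constructor
  · have : |v.1| * (|c| + α * |d|) ≤ |v.1| * (α * (|a| - α * |b|)) :=
      mul_le_mul_of_nonneg_left (by linarith) (abs_nonneg _)
    nlinarith
  · nlinarith [abs_nonneg v.1]

/-- If the image of a vector under the differential is in the stable cone, then so is the vector,
and it is contracted. -/
lemma fderiv_SCone (M : HyperbolicModel ι) {α K₀ : ℝ} (hα0 : 0 < α) (hα1 : α < 1) (hK : 1 < K₀)
    (hH : M.Hyperbolic α K₀) {i : ι} {z v w : ℝ × ℝ} (hz : z ∈ M.E i)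
    (hv : fderiv ℝ (M.f i) z v = w) (hw : |w.1| ≤ α * |w.2|) (hw0 : w.2 ≠ 0) :
    |v.1| ≤ α * |v.2| ∧ K₀ * |w.2| ≤ |v.2| := by
  rw [fderiv_apply_eq] at hv
  have h1 := hH.h1 i z hz
  have h2 := hH.h2 i z hz
  have h3 := hH.h3 i z hz
  have h4 := hH.h4 i z hz
  unfold absJacobian at h4
  have w1 := congrArg Prod.fst hv
  have w2 := congrArg Prod.snd hv
  simp only [Prod.fst_add, Prod.snd_add, Prod.smul_fst, Prod.smul_snd, smul_eq_mul] at w1 w2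
  set a := (partialX (M.f i) z).1
  set b := (partialY (M.f i) z).1
  set c := (partialX (M.f i) z).2
  set d := (partialY (M.f i) z).2
  set J := a * d - b * c
  -- Cramer's rule, without presupposing that Df is invertible: J ≠ 0 comes out below, from `e2` and
  -- the positivity of |a| - α|c|.
  have j1 : J * v.1 = d * w.1 - b * w.2 := by rw [← w1, ← w2]; ring
  have j2 : J * v.2 = a * w.2 - c * w.1 := by rw [← w1, ← w2]; ring
  have hpos : 0 < |w.2| := abs_pos.2 hw0
  have e1 : |J| * |v.1| ≤ (α * (|a| - α * |c|)) * |w.2| := by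
    rw [← abs_mul, j1]
    have := abs_sub (d * w.1) (b * w.2)
    rw [abs_mul, abs_mul] at this
    nlinarith [abs_nonneg d]
  have e2 : (|a| - α * |c|) * |w.2| ≤ |J| * |v.2| := by
    rw [← abs_mul, j2]
    have := abs_sub_abs_le_abs_sub (a * w.2) (c * w.1)
    rw [abs_mul, abs_mul] at this
    nlinarith [abs_nonneg c]
  have hac : 0 < |a| - α * |c| := by
    have h5 : |c| ≤ α * |a| := by
      have : 0 ≤ α * |d| := by positivity
      have : 0 ≤ α ^ 2 * |b| := by positivity
      linarith
    have h6 : 0 ≤ α * |b| := by positivity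
    have h7 : α * |c| ≤ α * (α * |a|) := mul_le_mul_of_nonneg_left h5 hα0.le
    have h8 : α * (α * |a|) < 1 * |a| := by
      rw [← mul_assoc]; exact mul_lt_mul_of_pos_right (by nlinarith) (by linarith)
    linarith
  have hJ : 0 < |J| := by
    rcases (abs_nonneg J).eq_or_lt with h | h
    · rw [← h, zero_mul] at e2
      exact absurd e2 (not_le.2 (mul_pos hac hpos))
    · exact h
  constructor
  · refine le_of_mul_le_mul_left ?_ hJ
    calc |J| * |v.1| ≤ α * ((|a| - α * |c|) * |w.2|) := by linarith
      _ ≤ α * (|J| * |v.2|) := mul_le_mul_of_nonneg_left e2 hα0.le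
      _ = _ := by ring
  · refine le_of_mul_le_mul_left ?_ hJ
    calc |J| * (K₀ * |w.2|) = (|J| * K₀) * |w.2| := by ring
      _ ≤ (|a| - α * |c|) * |w.2| := mul_le_mul_of_nonneg_right h4 hpos.le
      _ ≤ _ := e2

/-- `fderiv_UCone` integrated along the segment from z to w, which stays in `E_i` by `seg_mem_E`. -/
lemma f_UCone (M : HyperbolicModel ι) {α K₀ : ℝ} (hα0 : 0 < α) (hα1 : α < 1)
    (hK : 1 < K₀) (hH : M.Hyperbolic α K₀) {i : ι} {z w : ℝ × ℝ} (hz : z ∈ M.E i)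
    (hw : w ∈ M.E i) (hu : UCone α z w) :
    UCone α (M.f i z) (M.f i w) ∧ K₀ * |z.1 - w.1| ≤ |(M.f i z).1 - (M.f i w).1| := by
  by_cases h0 : z.1 - w.1 = 0
  · have : z = w := Prod.ext (sub_eq_zero.1 h0) (by
      unfold UCone at hu
      rw [h0] at hu
      exact sub_eq_zero.1 (abs_nonpos_iff.1 (by simpa using hu)))
    subst this
    simp [UCone]
  have hder : ∀ t ∈ Icc (0 : ℝ) 1,
      HasDerivAt (fun s => M.f i (seg z w s)) (fderiv ℝ (M.f i) (seg z w t) (w - z)) t :=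
    fun t ht => (M.hasFDerivAt_f (M.seg_mem_E hα0 hα1 hK hH hz hw hu ht)).comp_hasDerivAt t
      (hasDerivAt_seg z w t)
  have hcone : ∀ t ∈ Icc (0 : ℝ) 1, _ := fun t ht =>
    M.fderiv_UCone hα0 hH (M.seg_mem_E hα0 hα1 hK hH hz hw hu ht) (v := w - z) (by
      unfold UCone at hu
      rwa [Prod.fst_sub, Prod.snd_sub, abs_sub_comm, abs_sub_comm w.1])
  have := chord_mem_cone (k := K₀ * |(w - z).1|)
    (by
      have : 0 < |(w - z).1| := by
        rw [abs_pos, Prod.fst_sub]; intro h; exact h0 (by linarith)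
      have : 0 < K₀ := by linarith
      positivity)
    (fun t ht => (hasDerivAt_fst_snd (hder t ht)).1.hasDerivWithinAt)
    (fun t ht => (hasDerivAt_fst_snd (hder t ht)).2.hasDerivWithinAt)
    (fun t ht => (hcone t ht).1) (fun t ht => (hcone t ht).2)
  have s0 : seg z w 0 = z := by simp [seg]
  have s1 : seg z w 1 = w := by simp [seg]
  simp only [s0, s1, Prod.fst_sub] at this
  unfold UCone
  rw [abs_sub_comm, abs_sub_comm (M.f i z).1, abs_sub_comm z.1]
  exact this

lemma eq_of_fst_f_eq (M : HyperbolicModel ι) {α K₀ : ℝ} (hα0 : 0 < α) (hα1 : α < 1)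
    (hK : 1 < K₀) (hH : M.Hyperbolic α K₀) {i : ι} {z w : ℝ × ℝ} (hz : z ∈ M.E i)
    (hw : w ∈ M.E i) (hu : UCone α z w) (h : (M.f i z).1 = (M.f i w).1) : z = w := by
  have h1 := (M.f_UCone hα0 hα1 hK hH hz hw hu).2
  rw [h, sub_self, abs_zero] at h1
  have h2 : |z.1 - w.1| = 0 := by nlinarith [abs_nonneg (z.1 - w.1)]
  unfold UCone at hu
  rw [h2] at hu
  exact Prod.ext (sub_eq_zero.1 (abs_eq_zero.1 h2))
    (sub_eq_zero.1 (abs_nonpos_iff.1 (by simpa using hu)))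

/-! ### Crossing, graph transform and the shape of `S_i`. -/

/-- The image of a horizontal graph crosses the square. -/
lemma exists_mem_graph (M : HyperbolicModel ι) {α K₀ : ℝ} (hα0 : 0 < α) (hα1 : α < 1)
    (hK : 1 < K₀) (hH : M.Hyperbolic α K₀) (i : ι) {g : ℝ → ℝ} (hg : LipGraph α g) {x : ℝ}
    (hx : x ∈ Icc (0 : ℝ) 1) : ∃ z ∈ M.E i, z.2 = g z.1 ∧ (M.f i z).1 = x := by
  have hl := M.lipGraph_left hα0 hα1 hK hH i
  have hr := M.lipGraph_right hα0 hα1 hK hH i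
  obtain ⟨a, ha, hla⟩ := hg.exists_cross hl
  obtain ⟨b, hb, hrb⟩ := hg.exists_cross hr
  have hlip : ∀ {q : ℝ → ℝ}, LipGraph α q → ∀ s ∈ Icc (0 : ℝ) 1, ∀ t ∈ Icc (0 : ℝ) 1,
      |q (g s) - q (g t)| ≤ |s - t| ∧ (s ≠ t → |q (g s) - q (g t)| < |s - t|) := by
    intro q hq s hs t ht
    have h1 := hq.lip _ (hg.mapsTo hs) _ (hg.mapsTo ht)
    have h2 := hg.lip s hs t ht
    have h3 : α * |g s - g t| ≤ α * (α * |s - t|) := mul_le_mul_of_nonneg_left h2 hα0.le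
    have h4 : α * α < 1 := by nlinarith
    refine ⟨by nlinarith [abs_nonneg (s - t)], fun hne => ?_⟩
    have := abs_pos.2 (sub_ne_zero.2 hne)
    nlinarith
  have hlt : ∀ t ∈ Icc (0 : ℝ) 1, M.left i (g t) < M.right i (g t) := fun t ht =>
    M.left_lt_right i _ (hg.mapsTo ht)
  -- If b ≤ a, the slow variation of `right ∘ g` would give right(g a) ≤ a = left(g a).
  have hab : a < b := by
    by_contra hba
    rw [not_lt] at hba
    have h1 := (abs_le.1 (hlip hr a ha b hb).1).2
    rw [abs_of_nonneg (sub_nonneg.2 hba)] at h1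
    linarith [hlt a ha]
  have hE : ∀ t ∈ Icc a b, (t, g t) ∈ M.E i := by
    intro t ht
    have ht' : t ∈ Icc (0 : ℝ) 1 := ⟨ha.1.trans ht.1, ht.2.trans hb.2⟩
    have h1 := (abs_le.1 (hlip hl t ht' a ha).1).2
    have h2 := (abs_le.1 (hlip hr t ht' b hb).1).1
    rw [abs_of_nonneg (sub_nonneg.2 ht.1)] at h1
    rw [abs_of_nonpos (sub_nonpos.2 ht.2)] at h2
    exact ⟨hg.mapsTo ht', show M.left i (g t) ≤ t by linarith,
      show t ≤ M.right i (g t) by linarith⟩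
  have hcont : ContinuousOn (fun t => (M.f i (t, g t)).1) (Icc a b) := by
    have : ContinuousOn (fun t => (t, g t)) (Icc a b) :=
      continuousOn_id.prodMk (hg.continuousOn.mono (Icc_subset_Icc ha.1 hb.2))
    exact continuous_fst.comp_continuousOn ((M.continuousOn_f i).comp this hE)
  have haI : a ∈ Icc a b := left_mem_Icc.2 hab.le
  have hbI : b ∈ Icc a b := right_mem_Icc.2 hab.le
  -- By expansion F₁ is injective along the graph, so the two ends go to different vertical sides
  -- and the intermediate value theorem reaches every x in [0, 1].
  have hne : (M.f i (a, g a)).1 ≠ (M.f i (b, g b)).1 := by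
    intro h
    have := M.eq_of_fst_f_eq hα0 hα1 hK hH (hE a haI) (hE b hbI) (hg.lip a ha b hb) h
    exact hab.ne (congrArg Prod.fst this)
  have hfa := M.f_left i _ (hg.mapsTo ha)
  have hfb := M.f_right i _ (hg.mapsTo hb)
  rw [hla] at hfa
  rw [hrb] at hfb
  have hx' : x ∈ uIcc ((M.f i (a, g a)).1) ((M.f i (b, g b)).1) := by
    rcases hfa with h | h <;> rcases hfb with h' | h' <;> rw [h, h'] at hne ⊢
    · exact absurd rfl hne
    · rwa [uIcc_of_le zero_le_one]
    · rwa [uIcc_of_ge zero_le_one]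
    · exact absurd rfl hne
  have hivt := intermediate_value_uIcc (a := a) (b := b) (f := fun t => (M.f i (t, g t)).1)
    (by rwa [uIcc_of_le hab.le]) hx'
  obtain ⟨t, ht, htx⟩ := hivt
  rw [uIcc_of_le hab.le] at ht
  exact ⟨(t, g t), hE t ht, rfl, htx⟩

/-- The graph transform. -/
lemma exists_image_graph (M : HyperbolicModel ι) {α K₀ : ℝ} (hα0 : 0 < α) (hα1 : α < 1)
    (hK : 1 < K₀) (hH : M.Hyperbolic α K₀) (i : ι) {g : ℝ → ℝ} (hg : LipGraph α g) :
    ∃ G, LipGraph α G ∧ ∀ x ∈ Icc (0 : ℝ) 1, ∃ z ∈ M.E i, z.2 = g z.1 ∧ M.f i z = (x, G x) := by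
  have key : ∀ x ∈ Icc (0 : ℝ) 1, ∃ z ∈ M.E i, z.2 = g z.1 ∧ (M.f i z).1 = x := fun x hx =>
    M.exists_mem_graph hα0 hα1 hK hH i hg hx
  choose! z hz hzg hzx using key
  refine ⟨fun x => (M.f i (z x)).2, ⟨fun x hx => (M.mapsTo_unitSquare i (hz x hx)).2, ?_⟩,
    fun x hx => ⟨z x, hz x hx, hzg x hx, Prod.ext (hzx x hx) rfl⟩⟩
  intro s hs t ht
  have hu : UCone α (z s) (z t) := by
    unfold UCone
    rw [hzg s hs, hzg t ht]
    exact hg.lip _ (M.E_subset i (hz s hs)).1 _ (M.E_subset i (hz t ht)).1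
  have := (M.f_UCone hα0 hα1 hK hH (hz s hs) (hz t ht) hu).1
  unfold UCone at this
  rwa [hzx s hs, hzx t ht] at this

/-- The image `S_i` is the full width region between two horizontal graphs. -/
lemma exists_S_eq (M : HyperbolicModel ι) {α K₀ : ℝ} (hα0 : 0 < α) (hα1 : α < 1)
    (hK : 1 < K₀) (hH : M.Hyperbolic α K₀) (i : ι) :
    ∃ b t, LipGraph α b ∧ LipGraph α t ∧ ∀ z, z ∈ M.S i ↔ z.swap ∈ strip b t := by
  obtain ⟨G, hG, hG'⟩ := M.exists_image_graph hα0 hα1 hK hH i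
    (lipGraph_const hα0.le (left_mem_Icc.2 (zero_le_one' ℝ)))
  obtain ⟨H, hHl, hH'⟩ := M.exists_image_graph hα0 hα1 hK hH i
    (lipGraph_const hα0.le (right_mem_Icc.2 (zero_le_one' ℝ)))
  -- `f_i` may reverse the vertical orientation, so the images of bottom and top can come in either
  -- order.
  have hmin : LipGraph α fun x => min (G x) (H x) :=
    ⟨fun x hx => ⟨le_min (hG.mapsTo hx).1 (hHl.mapsTo hx).1,
      (min_le_left _ _).trans (hG.mapsTo hx).2⟩, fun s hs t ht =>
      (abs_min_sub_min_le_max _ _ _ _).trans (max_le (hG.lip s hs t ht) (hHl.lip s hs t ht))⟩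
  have hmax : LipGraph α fun x => max (G x) (H x) :=
    ⟨fun x hx => ⟨(hG.mapsTo hx).1.trans (le_max_left _ _),
      max_le (hG.mapsTo hx).2 (hHl.mapsTo hx).2⟩, fun s hs t ht =>
      (abs_max_sub_max_le_max _ _ _ _).trans (max_le (hG.lip s hs t ht) (hHl.lip s hs t ht))⟩
  refine ⟨_, _, hmin, hmax, ?_⟩
  -- The fibre F₁ = x is a continuous curve c ↦ (q c, c) over [0, 1]. Along it F₂ is continuous and
  -- injective, hence monotone, and fills the interval between its end values.
  have key : ∀ x ∈ Icc (0 : ℝ) 1, ∀ y, (x, y) ∈ M.S i ↔ y ∈ uIcc (G x) (H x) := by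
    intro x hx y
    have hq : ∀ c ∈ Icc (0 : ℝ) 1, ∃ s, (s, c) ∈ M.E i ∧ (M.f i (s, c)).1 = x := by
      intro c hc
      obtain ⟨z, hz, hzc, hzx⟩ := M.exists_mem_graph hα0 hα1 hK hH i (lipGraph_const hα0.le hc) hx
      have : z = (z.1, c) := Prod.ext rfl hzc
      exact ⟨z.1, this ▸ hz, this ▸ hzx⟩
    choose! q hqE hqx using hq
    have hqu : ∀ z ∈ M.E i, (M.f i z).1 = x → z = (q z.2, z.2) := fun z hz hzx =>
      M.eq_of_fst_f_eq hα0 hα1 hK hH hz (hqE _ hz.1)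
        (by unfold UCone; simpa using mul_nonneg hα0.le (abs_nonneg _))
        (hzx.trans (hqx _ hz.1).symm)
    -- Distinct points of one fibre of F₁ cannot differ by an unstable vector; the complement of
    -- that cone gives the constant 1/α.
    have hqlip : ∀ c ∈ Icc (0 : ℝ) 1, ∀ d ∈ Icc (0 : ℝ) 1, |q c - q d| ≤ (1 / α) * |c - d| := by
      intro c hc d hd
      by_contra hlt
      rw [not_le, one_div, inv_mul_lt_iff₀ hα0] at hlt
      have := M.eq_of_fst_f_eq hα0 hα1 hK hH (hqE c hc) (hqE d hd) hlt.le
        ((hqx c hc).trans (hqx d hd).symm)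
      rw [Prod.mk.injEq] at this
      rw [this.1, this.2] at hlt
      simp at hlt
    have hcurve : ContinuousOn (fun c => (q c, c)) (Icc 0 1) :=
      (continuousOn_of_lip hqlip).prodMk continuousOn_id
    have hk : ContinuousOn (fun c => (M.f i (q c, c)).2) (Icc 0 1) :=
      continuous_snd.comp_continuousOn ((M.continuousOn_f i).comp hcurve hqE)
    have hinj : InjOn (fun c => (M.f i (q c, c)).2) (Icc 0 1) := by
      intro c hc d hd hcd
      have := M.injOn_f i (hqE c hc) (hqE d hd)
        (Prod.ext ((hqx c hc).trans (hqx d hd).symm) hcd)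
      exact congrArg Prod.snd this
    have hend : ∀ {c : ℝ} {L : ℝ → ℝ}, (∃ z ∈ M.E i, z.2 = c ∧ M.f i z = (x, L x)) →
        (M.f i (q c, c)).2 = L x := by
      rintro c L ⟨z, hz, rfl, hfz⟩
      rw [← hqu z hz (by rw [hfz]), hfz]
    have h0 := hend (hG' x hx)
    have h1 := hend (hH' x hx)
    constructor
    · rintro ⟨z, hz, hfz⟩
      have hz' := hqu z hz (by rw [hfz])
      have hy : (M.f i (q z.2, z.2)).2 = y := by rw [← hz', hfz]
      rw [← h0, ← h1, ← hy]
      rcases hk.strictMonoOn_of_injOn_Icc' zero_le_one hinj with hm | hm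
      · exact mem_uIcc.2 (Or.inl ⟨hm.monotoneOn (left_mem_Icc.2 zero_le_one) hz.1 hz.1.1,
          hm.monotoneOn hz.1 (right_mem_Icc.2 zero_le_one) hz.1.2⟩)
      · exact mem_uIcc.2 (Or.inr ⟨hm.antitoneOn hz.1 (right_mem_Icc.2 zero_le_one) hz.1.2,
          hm.antitoneOn (left_mem_Icc.2 zero_le_one) hz.1 hz.1.1⟩)
    · intro hy
      rw [← h0, ← h1] at hy
      obtain ⟨c, hc, hcy⟩ := intermediate_value_uIcc (a := (0 : ℝ)) (b := 1)
        (f := fun c => (M.f i (q c, c)).2) (by rwa [uIcc_of_le zero_le_one]) hy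
      rw [uIcc_of_le zero_le_one] at hc
      exact ⟨(q c, c), hqE c hc, Prod.ext (hqx c hc) hcy⟩
  intro z
  constructor
  · intro hz
    obtain ⟨w, hw, rfl⟩ := hz
    have hx := (M.mapsTo_unitSquare i hw).1
    have := (key _ hx (M.f i w).2).1 ⟨w, hw, rfl⟩
    exact ⟨hx, this.1, this.2⟩
  · rintro ⟨hx, h1, h2⟩
    exact (key _ hx z.2).2 ⟨h1, h2⟩

/-- The segment between the two images is pulled back by the inverse map and `fderiv_SCone` is
integrated along it. The shape of `S_i` found above guarantees that this segment stays in `S_i`. -/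
lemma f_SCone (M : HyperbolicModel ι) {α K₀ : ℝ} (hα0 : 0 < α) (hα1 : α < 1)
    (hK : 1 < K₀) (hH : M.Hyperbolic α K₀) {i : ι} {z w : ℝ × ℝ} (hz : z ∈ M.E i)
    (hw : w ∈ M.E i) (hs : SCone α (M.f i z) (M.f i w)) :
    SCone α z w ∧ K₀ * |(M.f i z).2 - (M.f i w).2| ≤ |z.2 - w.2| := by
  by_cases h0 : (M.f i z).2 - (M.f i w).2 = 0
  · have h1 : M.f i z = M.f i w := Prod.ext (by
      unfold SCone at hs
      rw [h0] at hs
      exact sub_eq_zero.1 (abs_nonpos_iff.1 (by simpa using hs))) (sub_eq_zero.1 h0)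
    have := M.injOn_f i hz hw h1
    subst this
    simp [SCone]
  obtain ⟨b, t, hb, ht, hS⟩ := M.exists_S_eq hα0 hα1 hK hH i
  set z' := M.f i z with hz'
  set w' := M.f i w with hw'
  have hseg : ∀ s ∈ Icc (0 : ℝ) 1, seg z' w' s ∈ M.S i := by
    intro s hs'
    rw [hS]
    have := seg_mem_strip hα0 hα1 hb ht ((hS z').1 ⟨z, hz, rfl⟩) ((hS w').1 ⟨w, hw, rfl⟩)
      (show UCone α z'.swap w'.swap from hs) hs'
    simpa [seg] using this
  have hback : ∀ p ∈ M.S i, (M.f i).symm p ∈ M.E i ∧ p ∈ (M.f i).target := by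
    rintro p ⟨o, ho, rfl⟩
    rw [(M.f i).left_inv (M.subset_source i ho)]
    exact ⟨ho, (M.f i).map_source (M.subset_source i ho)⟩
  have hsymm : ∀ p ∈ M.S i, HasFDerivAt (M.f i).symm (fderiv ℝ (M.f i).symm p) p := fun p hp =>
    (((M.contDiffOn_symm i).contDiffAt
      ((M.f i).open_target.mem_nhds (hback p hp).2)).differentiableAt (by norm_num)).hasFDerivAt
  have hinv : ∀ p ∈ M.S i, ∀ v,
      fderiv ℝ (M.f i) ((M.f i).symm p) (fderiv ℝ (M.f i).symm p v) = v := by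
    intro p hp v
    have h1 := (M.hasFDerivAt_f (hback p hp).1).comp p (hsymm p hp)
    have h2 : HasFDerivAt (M.f i ∘ (M.f i).symm) (ContinuousLinearMap.id ℝ (ℝ × ℝ)) p := by
      refine (hasFDerivAt_id p).congr_of_eventuallyEq ?_
      filter_upwards [(M.f i).open_target.mem_nhds (hback p hp).2] with o ho
      exact (M.f i).right_inv ho
    have := h1.unique h2
    exact DFunLike.congr_fun this v
  have hder : ∀ s ∈ Icc (0 : ℝ) 1, HasDerivAt (fun s => (M.f i).symm (seg z' w' s))
      (fderiv ℝ (M.f i).symm (seg z' w' s) (w' - z')) s := fun s hs' =>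
    (hsymm _ (hseg s hs')).comp_hasDerivAt s (hasDerivAt_seg z' w' s)
  have hne : (w' - z').2 ≠ 0 := by
    rw [Prod.snd_sub]; intro h; exact h0 (by linarith)
  have hcone : ∀ s ∈ Icc (0 : ℝ) 1, _ := fun s hs' =>
    M.fderiv_SCone hα0 hα1 hK hH (hback _ (hseg s hs')).1 (hinv _ (hseg s hs') (w' - z'))
      (by
        unfold SCone at hs
        rwa [Prod.fst_sub, Prod.snd_sub, abs_sub_comm, abs_sub_comm w'.2]) hne
  have := chord_mem_cone (k := K₀ * |(w' - z').2|)
    (by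
      have := abs_pos.2 hne
      have : 0 < K₀ := by linarith
      positivity)
    (fun t ht => (hasDerivAt_fst_snd (hder t ht)).2.hasDerivWithinAt)
    (fun t ht => (hasDerivAt_fst_snd (hder t ht)).1.hasDerivWithinAt)
    (fun t ht => (hcone t ht).1) (fun t ht => (hcone t ht).2)
  have s0 : (M.f i).symm (seg z' w' 0) = z := by
    simp [seg, hz', (M.f i).left_inv (M.subset_source i hz)]
  have s1 : (M.f i).symm (seg z' w' 1) = w := by
    simp [seg, hw', (M.f i).left_inv (M.subset_source i hw)]
  simp only [s0, s1, Prod.snd_sub] at this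
  unfold SCone
  rw [abs_sub_comm, abs_sub_comm z'.2, abs_sub_comm z.2]
  exact this

/-- The map `f_i` on `E_i` is a hyperbolic relation. -/
lemma hypRel_f (M : HyperbolicModel ι) {α K₀ : ℝ} (hα0 : 0 < α) (hα1 : α < 1)
    (hK : 1 < K₀) (hH : M.Hyperbolic α K₀) (i : ι) :
    HypRel α K₀ fun z z' => z ∈ M.E i ∧ z' = M.f i z where
  dom := by rintro z _ ⟨hz, rfl⟩; exact ⟨M.E_subset i hz, M.mapsTo_unitSquare i hz⟩
  unst := by rintro z _ w _ ⟨hz, rfl⟩ ⟨hw, rfl⟩ hu; exact M.f_UCone hα0 hα1 hK hH hz hw hu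
  stab := by rintro z _ w _ ⟨hz, rfl⟩ ⟨hw, rfl⟩ hs; exact M.f_SCone hα0 hα1 hK hH hz hw hs
  full {g h} hg hh := by
    obtain ⟨G, hG, hG'⟩ := M.exists_image_graph hα0 hα1 hK hH i hg
    obtain ⟨x, hx, hx'⟩ := hG.exists_cross hh
    obtain ⟨z, hz, hzg, hfz⟩ := hG' x hx
    exact ⟨z, M.f i z, ⟨hz, rfl⟩, hzg, by rw [hfz]; exact hx'.symm⟩

/-! ## Cylinders, stable and unstable sets -/

/-- The graph of `Fⁿ` on the cylinder `E_{i_0 … i_{n-1}}`. -/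
def forwardRel (M : HyperbolicModel ι) : ℕ → (ℕ → ι) → ℝ × ℝ → ℝ × ℝ → Prop
  | 0, _ => fun z z' => z = z' ∧ z ∈ unitSquare
  | n + 1, x => fun z z'' => ∃ z', (z ∈ M.E (x 0) ∧ z' = M.f (x 0) z) ∧
      forwardRel M n (fun k => x (k + 1)) z' z''

/-- The graph of `Fᵐ` onto the cylinder `S_{i_{-m} … i_{-1}}`. -/
def backwardRel (M : HyperbolicModel ι) : ℕ → (ℕ → ι) → ℝ × ℝ → ℝ × ℝ → Prop
  | 0, _ => fun z z' => z = z' ∧ z ∈ unitSquare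
  | m + 1, ξ => fun z z'' => ∃ z', backwardRel M m (fun k => ξ (k + 1)) z z' ∧
      (z' ∈ M.E (ξ 0) ∧ z'' = M.f (ξ 0) z')

lemma hypRel_forwardRel (M : HyperbolicModel ι) {α K₀ : ℝ} (hα0 : 0 < α) (hα1 : α < 1)
    (hK : 1 < K₀) (hH : M.Hyperbolic α K₀) (n : ℕ) (x : ℕ → ι) :
    HypRel α (K₀ ^ n) (M.forwardRel n x) := by
  have hK0 : 0 ≤ K₀ := by linarith
  induction n generalizing x with
  | zero => rw [pow_zero]; exact hypRel_id
  | succ n ih =>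
    rw [pow_succ']
    exact (M.hypRel_f hα0 hα1 hK hH (x 0)).comp hα0.le hK0 (by positivity) (ih _)

lemma hypRel_backwardRel (M : HyperbolicModel ι) {α K₀ : ℝ} (hα0 : 0 < α) (hα1 : α < 1)
    (hK : 1 < K₀) (hH : M.Hyperbolic α K₀) (m : ℕ) (ξ : ℕ → ι) :
    HypRel α (K₀ ^ m) (M.backwardRel m ξ) := by
  have hK0 : 0 ≤ K₀ := by linarith
  induction m generalizing ξ with
  | zero => rw [pow_zero]; exact hypRel_id
  | succ m ih =>
    rw [pow_succ]
    exact (ih _).comp hα0.le (by positivity) hK0 (M.hypRel_f hα0 hα1 hK hH (ξ 0))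

/-- Lets the results on abstract hyperbolic relations apply to cylinders. -/
lemma mem_cylinderE_iff (M : HyperbolicModel ι) {n : ℕ} {x : ℕ → ι} {z : ℝ × ℝ} :
    z ∈ M.cylinderE n x ↔ ∃ z', M.forwardRel n x z z' := by
  induction n generalizing x z with
  | zero => simp [cylinderE, forwardRel]
  | succ n ih =>
    simp only [cylinderE, forwardRel, mem_inter_iff, mem_preimage, ih]
    constructor
    · rintro ⟨h1, z', h2⟩; exact ⟨z', _, ⟨h1, rfl⟩, h2⟩
    · rintro ⟨z', _, ⟨h1, rfl⟩, h2⟩; exact ⟨h1, z', h2⟩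

lemma mem_cylinderS_iff (M : HyperbolicModel ι) {m : ℕ} {ξ : ℕ → ι} {z : ℝ × ℝ} :
    z ∈ M.cylinderS m ξ ↔ ∃ z', M.backwardRel m ξ z' z := by
  induction m generalizing ξ z with
  | zero => simp [cylinderS, backwardRel]
  | succ m ih =>
    simp only [cylinderS, backwardRel, mem_image, mem_inter_iff, ih]
    constructor
    · rintro ⟨w, ⟨⟨z', h1⟩, h2⟩, rfl⟩; exact ⟨z', w, h1, h2, rfl⟩
    · rintro ⟨z', w, h1, h2, rfl⟩; exact ⟨w, ⟨⟨z', h1⟩, h2⟩, rfl⟩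

/-! ### Compactness of cylinders; stable and unstable sets. -/

lemma isCompact_unitSquare : IsCompact unitSquare := isCompact_Icc.prod isCompact_Icc

lemma isClosed_E (M : HyperbolicModel ι) (i : ι) : IsClosed (M.E i) := by
  have hT : IsClosed {z : ℝ × ℝ | z.2 ∈ Icc (0 : ℝ) 1} := isClosed_Icc.preimage continuous_snd
  have hl : ContinuousOn (fun z : ℝ × ℝ => M.left i z.2) {z | z.2 ∈ Icc (0 : ℝ) 1} :=
    (M.continuousOn_left i).comp continuous_snd.continuousOn fun _ h => h
  have hr : ContinuousOn (fun z : ℝ × ℝ => M.right i z.2) {z | z.2 ∈ Icc (0 : ℝ) 1} :=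
    (M.continuousOn_right i).comp continuous_snd.continuousOn fun _ h => h
  convert (IsClosed.isClosed_le hT hl continuous_fst.continuousOn).inter
    (IsClosed.isClosed_le hT continuous_fst.continuousOn hr) using 1
  ext z
  constructor
  · rintro ⟨h1, h2, h3⟩; exact ⟨⟨h1, h2⟩, h1, h3⟩
  · rintro ⟨⟨h1, h2⟩, -, h3⟩; exact ⟨h1, h2, h3⟩

lemma isCompact_cylinderE (M : HyperbolicModel ι) (n : ℕ) (x : ℕ → ι) :
    IsCompact (M.cylinderE n x) := by
  induction n generalizing x with
  | zero => exact isCompact_unitSquare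
  | succ n ih =>
    have hcl := (M.continuousOn_f (x 0)).preimage_isClosed_of_isClosed (M.isClosed_E (x 0))
      (ih fun k => x (k + 1)).isClosed
    exact isCompact_unitSquare.of_isClosed_subset hcl
      (inter_subset_left.trans (M.E_subset _))

lemma isCompact_cylinderS (M : HyperbolicModel ι) (m : ℕ) (ξ : ℕ → ι) :
    IsCompact (M.cylinderS m ξ) := by
  induction m generalizing ξ with
  | zero => exact isCompact_unitSquare
  | succ m ih =>
    exact ((ih _).inter_right (M.isClosed_E _)).image_of_continuousOn
      ((M.continuousOn_f _).mono inter_subset_right)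

lemma cylinderE_succ_subset (M : HyperbolicModel ι) (n : ℕ) (x : ℕ → ι) :
    M.cylinderE (n + 1) x ⊆ M.cylinderE n x := by
  induction n generalizing x with
  | zero => exact inter_subset_left.trans (M.E_subset _)
  | succ n ih => exact inter_subset_inter_right _ (preimage_mono (ih _))

lemma cylinderS_succ_subset (M : HyperbolicModel ι) (m : ℕ) (ξ : ℕ → ι) :
    M.cylinderS (m + 1) ξ ⊆ M.cylinderS m ξ := by
  induction m generalizing ξ with
  | zero =>
    rintro _ ⟨z, hz, rfl⟩
    exact M.mapsTo_unitSquare _ hz.2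
  | succ m ih => exact image_mono (inter_subset_inter_left _ (ih _))

lemma inter_iInter_nonempty {X : Type*} [TopologicalSpace X] [T2Space X] {A : ℕ → Set X}
    {B : Set X} (hA : ∀ n, IsCompact (A n)) (hmono : ∀ n, A (n + 1) ⊆ A n) (hB : IsClosed B)
    (hne : ∀ n, (A n ∩ B).Nonempty) : ((⋂ n, A n) ∩ B).Nonempty := by
  rw [iInter_inter]
  exact IsCompact.nonempty_iInter_of_sequence_nonempty_isCompact_isClosed _
    (fun n => inter_subset_inter_left _ (hmono n)) hne ((hA 0).inter_right hB)
    fun n => (hA n).isClosed.inter hB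

lemma SCone_of_mem_stableSet (M : HyperbolicModel ι) {α K₀ : ℝ} (hα0 : 0 < α) (hα1 : α < 1)
    (hK : 1 < K₀) (hH : M.Hyperbolic α K₀) {x : ℕ → ι} {z w : ℝ × ℝ} (hz : z ∈ M.stableSet x)
    (hw : w ∈ M.stableSet x) : SCone α z w :=
  SCone_of_forall_hypRel hα0.le hK (fun n => M.hypRel_forwardRel hα0 hα1 hK hH n x)
    (fun n => M.mem_cylinderE_iff.1 (mem_iInter.1 hz n))
    (fun n => M.mem_cylinderE_iff.1 (mem_iInter.1 hw n))

lemma UCone_of_mem_unstableSet (M : HyperbolicModel ι) {α K₀ : ℝ} (hα0 : 0 < α) (hα1 : α < 1)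
    (hK : 1 < K₀) (hH : M.Hyperbolic α K₀) {ξ : ℕ → ι} {z w : ℝ × ℝ} (hz : z ∈ M.unstableSet ξ)
    (hw : w ∈ M.unstableSet ξ) : UCone α z w :=
  UCone_of_forall_hypRel hα0.le hK (fun n => M.hypRel_backwardRel hα0 hα1 hK hH n ξ)
    (fun n => M.mem_cylinderS_iff.1 (mem_iInter.1 hz n))
    (fun n => M.mem_cylinderS_iff.1 (mem_iInter.1 hw n))

lemma exists_mem_stableSet (M : HyperbolicModel ι) {α K₀ : ℝ} (hα0 : 0 < α) (hα1 : α < 1)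
    (hK : 1 < K₀) (hH : M.Hyperbolic α K₀) (x : ℕ → ι) {y : ℝ} (hy : y ∈ Icc (0 : ℝ) 1) :
    ∃ s, (s, y) ∈ M.stableSet x := by
  obtain ⟨z, hz, hzy⟩ := inter_iInter_nonempty (fun n => M.isCompact_cylinderE n x)
    (fun n => M.cylinderE_succ_subset n x) (isClosed_singleton.preimage continuous_snd)
    (B := Prod.snd ⁻¹' {y}) fun n => by
      obtain ⟨z, z', h, h1, -⟩ := (M.hypRel_forwardRel hα0 hα1 hK hH n x).full
        (lipGraph_const hα0.le hy) (lipGraph_const hα0.le hy)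
      exact ⟨z, M.mem_cylinderE_iff.2 ⟨z', h⟩, h1⟩
  have : z = (z.1, y) := Prod.ext rfl hzy
  exact ⟨z.1, this ▸ hz⟩

lemma exists_mem_unstableSet (M : HyperbolicModel ι) {α K₀ : ℝ} (hα0 : 0 < α) (hα1 : α < 1)
    (hK : 1 < K₀) (hH : M.Hyperbolic α K₀) (ξ : ℕ → ι) {x : ℝ} (hx : x ∈ Icc (0 : ℝ) 1) :
    ∃ y, (x, y) ∈ M.unstableSet ξ := by
  obtain ⟨z, hz, hzx⟩ := inter_iInter_nonempty (fun n => M.isCompact_cylinderS n ξ)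
    (fun n => M.cylinderS_succ_subset n ξ) (isClosed_singleton.preimage continuous_fst)
    (B := Prod.fst ⁻¹' {x}) fun n => by
      obtain ⟨z, z', h, -, h1⟩ := (M.hypRel_backwardRel hα0 hα1 hK hH n ξ).full
        (lipGraph_const hα0.le hx) (lipGraph_const hα0.le hx)
      exact ⟨z', M.mem_cylinderS_iff.2 ⟨z, h⟩, h1⟩
  have : z = (x, z.2) := Prod.ext hzx rfl
  exact ⟨z.2, this ▸ hz⟩

/-- The intermediate point of the composite of `backwardRel n` and `forwardRel n` lies in both
cylinders; compactness then gives a point for all n. The constant graphs fed to `full` play no role.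
-/
lemma stableSet_inter_unstableSet_nonempty (M : HyperbolicModel ι) {α K₀ : ℝ} (hα0 : 0 < α)
    (hα1 : α < 1) (hK : 1 < K₀) (hH : M.Hyperbolic α K₀) (x ξ : ℕ → ι) :
    (M.stableSet x ∩ M.unstableSet ξ).Nonempty := by
  have hK0 : 0 ≤ K₀ := by linarith
  have h0 : (0 : ℝ) ∈ Icc (0 : ℝ) 1 := left_mem_Icc.2 zero_le_one
  obtain ⟨z, hz, -⟩ := inter_iInter_nonempty (A := fun n => M.cylinderE n x ∩ M.cylinderS n ξ)
    (fun n => (M.isCompact_cylinderE n x).inter (M.isCompact_cylinderS n ξ))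
    (fun n => inter_subset_inter (M.cylinderE_succ_subset n x) (M.cylinderS_succ_subset n ξ))
    isClosed_univ fun n => by
      obtain ⟨_, _, ⟨z, h1, h2⟩, -⟩ := ((M.hypRel_backwardRel hα0 hα1 hK hH n ξ).comp hα0.le
        (by positivity) (by positivity) (M.hypRel_forwardRel hα0 hα1 hK hH n x)).full
        (lipGraph_const hα0.le h0) (lipGraph_const hα0.le h0)
      exact ⟨z, ⟨M.mem_cylinderE_iff.2 ⟨_, h2⟩, M.mem_cylinderS_iff.2 ⟨_, h1⟩⟩, trivial⟩
  rw [mem_iInter] at hz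
  exact ⟨z, mem_iInter.2 fun n => (hz n).1, mem_iInter.2 fun n => (hz n).2⟩

lemma unstableSet_subset (M : HyperbolicModel ι) (ξ : ℕ → ι) : M.unstableSet ξ ⊆ unitSquare :=
  fun _ hz => mem_iInter.1 hz 0

lemma stableSet_subset (M : HyperbolicModel ι) (x : ℕ → ι) : M.stableSet x ⊆ unitSquare :=
  fun _ hz => mem_iInter.1 hz 0

lemma mem_E_of_mem_stableSet (M : HyperbolicModel ι) {x : ℕ → ι} {z : ℝ × ℝ}
    (hz : z ∈ M.stableSet x) : z ∈ M.E (x 0) := (mem_iInter.1 hz 1).1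

lemma f_mem_stableSet (M : HyperbolicModel ι) {x : ℕ → ι} {z : ℝ × ℝ}
    (hz : z ∈ M.stableSet x) : M.f (x 0) z ∈ M.stableSet fun k => x (k + 1) :=
  mem_iInter.2 fun n => (mem_iInter.1 hz (n + 1)).2

lemma f_mem_unstableSet (M : HyperbolicModel ι) {ξ : ℕ → ι} {z : ℝ × ℝ}
    (hz : z ∈ M.unstableSet fun k => ξ (k + 1)) (hE : z ∈ M.E (ξ 0)) :
    M.f (ξ 0) z ∈ M.unstableSet ξ := by
  refine mem_iInter.2 fun n => ?_
  cases n with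
  | zero => exact M.mapsTo_unitSquare _ hE
  | succ n => exact ⟨z, ⟨mem_iInter.1 hz n, hE⟩, rfl⟩

lemma exists_preimage_of_mem_unstableSet (M : HyperbolicModel ι) {ξ : ℕ → ι} {z : ℝ × ℝ}
    (hz : z ∈ M.unstableSet ξ) :
    ∃ w ∈ M.unstableSet fun k => ξ (k + 1), w ∈ M.E (ξ 0) ∧ M.f (ξ 0) w = z := by
  have h : ∀ n, ∃ w, (w ∈ M.cylinderS n fun k => ξ (k + 1)) ∧ w ∈ M.E (ξ 0) ∧ M.f (ξ 0) w = z := by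
    intro n
    obtain ⟨w, hw, hfw⟩ := mem_iInter.1 hz (n + 1)
    exact ⟨w, hw.1, hw.2, hfw⟩
  choose w hw hE hf using h
  -- The preimage found in the n-th cylinder does not depend on n, because `f` is injective on the
  -- rectangle.
  refine ⟨w 0, mem_iInter.2 fun n => ?_, hE 0, hf 0⟩
  rw [M.injOn_f _ (hE 0) (hE n) ((hf 0).trans (hf n).symm)]
  exact hw n

lemma mem_unstableSet_iff (M : HyperbolicModel ι) {α K₀ : ℝ} (hα0 : 0 < α) (hα1 : α < 1)
    (hK : 1 < K₀) (hH : M.Hyperbolic α K₀) {ξ : ℕ → ι} {z : ℝ × ℝ} :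
    z ∈ M.unstableSet ξ ↔ z.1 ∈ Icc (0 : ℝ) 1 ∧ z.2 = M.unstableFun ξ z.1 := by
  have key : ∀ x y, (x, y) ∈ M.unstableSet ξ → M.unstableFun ξ x = y := by
    intro x y hxy
    have : {y' | (x, y') ∈ M.unstableSet ξ} = {y} := by
      refine eq_singleton_iff_unique_mem.2 ⟨hxy, fun y' hy' => ?_⟩
      have := M.UCone_of_mem_unstableSet hα0 hα1 hK hH hy' hxy
      unfold UCone at this
      exact sub_eq_zero.1 (abs_nonpos_iff.1 (by simpa using this))
    rw [unstableFun, this, csSup_singleton]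
  constructor
  · intro hz
    exact ⟨(M.unstableSet_subset ξ hz).1, (key z.1 z.2 hz).symm⟩
  · rintro ⟨h1, h2⟩
    obtain ⟨y, hy⟩ := M.exists_mem_unstableSet hα0 hα1 hK hH ξ h1
    rw [key _ _ hy] at h2
    have : z = (z.1, y) := Prod.ext rfl h2
    rwa [this]

lemma graph_mem_unstableSet (M : HyperbolicModel ι) {α K₀ : ℝ} (hα0 : 0 < α) (hα1 : α < 1)
    (hK : 1 < K₀) (hH : M.Hyperbolic α K₀) (ξ : ℕ → ι) {x : ℝ} (hx : x ∈ Icc (0 : ℝ) 1) :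
    (x, M.unstableFun ξ x) ∈ M.unstableSet ξ :=
  (M.mem_unstableSet_iff hα0 hα1 hK hH).2 ⟨hx, rfl⟩

lemma lipGraph_unstableFun (M : HyperbolicModel ι) {α K₀ : ℝ} (hα0 : 0 < α) (hα1 : α < 1)
    (hK : 1 < K₀) (hH : M.Hyperbolic α K₀) (ξ : ℕ → ι) : LipGraph α (M.unstableFun ξ) where
  mapsTo _ hx := (M.unstableSet_subset ξ (M.graph_mem_unstableSet hα0 hα1 hK hH ξ hx)).2
  lip _ hs _ ht := M.UCone_of_mem_unstableSet hα0 hα1 hK hH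
    (M.graph_mem_unstableSet hα0 hα1 hK hH ξ hs) (M.graph_mem_unstableSet hα0 hα1 hK hH ξ ht)

/-! ## Two-sided sequences -/

lemma past_glue (ξ x : ℕ → ι) : past (glue ξ x) = ξ := by
  funext k
  have : -((k : ℤ) + 1) = Int.negSucc k := by rw [Int.negSucc_eq]
  rw [past, this]; rfl

lemma future_glue (ξ x : ℕ → ι) : future (glue ξ x) = x := rfl

lemma future_shift (ω : ℤ → ι) : future (shift ω) = fun k => future ω (k + 1) := by
  funext k; simp [future, shift]

lemma past_shift_succ (ω : ℤ → ι) : (fun k => past (shift ω) (k + 1)) = past ω := by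
  funext k; simp [past, shift]

lemma past_shift_zero (ω : ℤ → ι) : past (shift ω) 0 = ω 0 := by
  simp [past, shift]

lemma future_zero (ω : ℤ → ι) : future ω 0 = ω 0 := by simp [future]

lemma point_mem (M : HyperbolicModel ι) {α K₀ : ℝ} (hα0 : 0 < α) (hα1 : α < 1)
    (hK : 1 < K₀) (hH : M.Hyperbolic α K₀) (ω : ℤ → ι) :
    M.point ω ∈ M.stableSet (future ω) ∩ M.unstableSet (past ω) :=
  Classical.epsilon_spec (M.stableSet_inter_unstableSet_nonempty hα0 hα1 hK hH _ _)

lemma eq_point (M : HyperbolicModel ι) {α K₀ : ℝ} (hα0 : 0 < α) (hα1 : α < 1)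
    (hK : 1 < K₀) (hH : M.Hyperbolic α K₀) {ω : ℤ → ι} {z : ℝ × ℝ}
    (hz : z ∈ M.stableSet (future ω) ∩ M.unstableSet (past ω)) : z = M.point ω := by
  have hp := M.point_mem hα0 hα1 hK hH ω
  exact eq_of_UCone_of_SCone hα1 (M.UCone_of_mem_unstableSet hα0 hα1 hK hH hz.2 hp.2)
    (M.SCone_of_mem_stableSet hα0 hα1 hK hH hz.1 hp.1)

lemma point_mem_E (M : HyperbolicModel ι) {α K₀ : ℝ} (hα0 : 0 < α) (hα1 : α < 1)
    (hK : 1 < K₀) (hH : M.Hyperbolic α K₀) (ω : ℤ → ι) : M.point ω ∈ M.E (ω 0) := by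
  have := M.mem_E_of_mem_stableSet (M.point_mem hα0 hα1 hK hH ω).1
  rwa [future_zero] at this

lemma f_point (M : HyperbolicModel ι) {α K₀ : ℝ} (hα0 : 0 < α) (hα1 : α < 1)
    (hK : 1 < K₀) (hH : M.Hyperbolic α K₀) (ω : ℤ → ι) :
    M.f (ω 0) (M.point ω) = M.point (shift ω) := by
  have hp := M.point_mem hα0 hα1 hK hH ω
  refine M.eq_point hα0 hα1 hK hH ⟨?_, ?_⟩
  · rw [future_shift]
    exact future_zero ω ▸ M.f_mem_stableSet hp.1
  · rw [← past_shift_zero ω]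
    refine M.f_mem_unstableSet ?_ ?_
    · rw [past_shift_succ]; exact hp.2
    · rw [past_shift_zero]; exact M.point_mem_E hα0 hα1 hK hH ω

/-! ## The action of the differential on slopes -/

/-- The slope of the image under `Df_i(z)` of a vector of slope `a`. -/
def slopeMap (M : HyperbolicModel ι) (i : ι) (z : ℝ × ℝ) (a : ℝ) : ℝ :=
  (fderiv ℝ (M.f i) z (1, a)).2 / (fderiv ℝ (M.f i) z (1, a)).1

/-- The contraction rate of the slope maps. -/
def slopeRate (α K₀ : ℝ) : ℝ := 1 / (K₀ ^ 2 * (1 - α ^ 2))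

lemma slopeRate_pos {α K₀ : ℝ} (hα0 : 0 < α) (hα1 : α < 1) (hK : 1 < K₀) :
    0 < slopeRate α K₀ := by
  have : 0 < 1 - α ^ 2 := by nlinarith
  have : 0 < K₀ := by linarith
  unfold slopeRate; positivity

lemma slopeRate_lt_one {α K₀ : ℝ} (hα0 : 0 < α) (hα1 : α < 1) (hK : 1 < K₀)
    (h5 : 1 / K₀ ^ 2 + α ^ 2 < 1) : slopeRate α K₀ < 1 := by
  have h1 : 0 < 1 - α ^ 2 := by nlinarith
  have h2 : 0 < K₀ ^ 2 := by nlinarith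
  unfold slopeRate
  rw [div_lt_one (by positivity)]
  have : 1 / K₀ ^ 2 < 1 - α ^ 2 := by linarith
  rw [div_lt_iff₀ h2] at this
  linarith

lemma fderiv_one_apply (g : ℝ × ℝ → ℝ × ℝ) (z : ℝ × ℝ) (a : ℝ) :
    fderiv ℝ g z (1, a) = partialX g z + a • partialY g z := by
  rw [fderiv_apply_eq]; simp

lemma abs_partials_le (M : HyperbolicModel ι) {α K₀ : ℝ} (hα0 : 0 < α)
    (hH : M.Hyperbolic α K₀) {i : ι} {z : ℝ × ℝ} (hz : z ∈ M.E i) :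
    |(partialX (M.f i) z).2| ≤ α * |(partialX (M.f i) z).1| ∧
    |(partialY (M.f i) z).1| ≤ α * |(partialX (M.f i) z).1| := by
  have h1 := hH.h1 i z hz
  have h3 := hH.h3 i z hz
  have e1 : 0 ≤ α * |(partialY (M.f i) z).2| := by positivity
  have e2 : 0 ≤ α ^ 2 * |(partialY (M.f i) z).1| := by positivity
  have e3 : 0 ≤ α ^ 2 * |(partialX (M.f i) z).2| := by positivity
  exact ⟨by linarith, by linarith⟩

lemma fderiv_one_bounds (M : HyperbolicModel ι) {α K₀ : ℝ} (hα0 : 0 < α)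
    (hH : M.Hyperbolic α K₀) {i : ι} {z : ℝ × ℝ} (hz : z ∈ M.E i) {a : ℝ} (ha : |a| ≤ α) :
    (1 - α ^ 2) * |(partialX (M.f i) z).1| ≤ |(fderiv ℝ (M.f i) z (1, a)).1| ∧
    K₀ ≤ |(fderiv ℝ (M.f i) z (1, a)).1| ∧
    |(fderiv ℝ (M.f i) z (1, a)).2| ≤ α * |(fderiv ℝ (M.f i) z (1, a)).1| := by
  have h := M.fderiv_UCone hα0 hH hz (v := (1, a)) (by simpa using ha)
  refine ⟨?_, by simpa using h.2, h.1⟩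
  have hY := (M.abs_partials_le hα0 hH hz).2
  rw [fderiv_one_apply]
  simp only [Prod.fst_add, Prod.smul_fst, smul_eq_mul]
  set X := (partialX (M.f i) z).1
  set Y := (partialY (M.f i) z).1
  have h1 := abs_sub (X + a * Y) (a * Y)
  rw [add_sub_cancel_right, abs_mul] at h1
  have h2 : |a| * |Y| ≤ α * (α * |X|) := mul_le_mul ha hY (abs_nonneg _) hα0.le
  linarith

lemma abs_slopeMap_le (M : HyperbolicModel ι) {α K₀ : ℝ} (hα0 : 0 < α) (hK : 1 < K₀)
    (hH : M.Hyperbolic α K₀) {i : ι} {z : ℝ × ℝ} (hz : z ∈ M.E i) {a : ℝ} (ha : |a| ≤ α) :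
    |M.slopeMap i z a| ≤ α := by
  obtain ⟨-, h2, h3⟩ := M.fderiv_one_bounds hα0 hH hz ha
  rw [slopeMap, abs_div, div_le_iff₀ (by linarith)]
  exact h3

/-- The slope map is a Möbius map, and its difference quotient is J/(D D') with D, D' the two
denominators. H4 gives |J| K₀ ≤ |F₁ₓ|, while |D| ≥ (1-α²)|F₁ₓ| and |D'| ≥ K₀. -/
lemma abs_slopeMap_sub_le (M : HyperbolicModel ι) {α K₀ : ℝ} (hα0 : 0 < α) (hα1 : α < 1)
    (hK : 1 < K₀) (hH : M.Hyperbolic α K₀) {i : ι} {z : ℝ × ℝ} (hz : z ∈ M.E i) {a b : ℝ}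
    (ha : |a| ≤ α) (hb : |b| ≤ α) :
    |M.slopeMap i z a - M.slopeMap i z b| ≤ slopeRate α K₀ * |a - b| := by
  have h1α : 0 < 1 - α ^ 2 := by nlinarith
  have hK0 : 0 < K₀ := by linarith
  obtain ⟨a1, a2, -⟩ := M.fderiv_one_bounds hα0 hH hz ha
  obtain ⟨-, b2, -⟩ := M.fderiv_one_bounds hα0 hH hz hb
  have h4 := hH.h4 i z hz
  unfold slopeMap absJacobian slopeRate at *
  rw [fderiv_one_apply] at a1 a2 b2
  rw [fderiv_one_apply, fderiv_one_apply]
  simp only [Prod.fst_add, Prod.snd_add, Prod.smul_fst, Prod.smul_snd, smul_eq_mul] at *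
  set X := (partialX (M.f i) z).1
  set Y := (partialY (M.f i) z).1
  set Z := (partialX (M.f i) z).2
  set W := (partialY (M.f i) z).2
  have hD : X + a * Y ≠ 0 := abs_pos.1 (by linarith)
  have hD' : X + b * Y ≠ 0 := abs_pos.1 (by linarith)
  have heq : (Z + a * W) / (X + a * Y) - (Z + b * W) / (X + b * Y) =
      (X * W - Y * Z) * (a - b) / ((X + a * Y) * (X + b * Y)) := by
    rw [div_sub_div _ _ hD hD']; congr 1; ring
  have hJ : |X * W - Y * Z| * K₀ ≤ |X| := by
    have : 0 ≤ α * |Z| := by positivity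
    linarith
  have h6 : |X| * (K₀ * (1 - α ^ 2)) ≤ |X + a * Y| * |X + b * Y| := by
    calc |X| * (K₀ * (1 - α ^ 2)) = ((1 - α ^ 2) * |X|) * K₀ := by ring
      _ ≤ _ := mul_le_mul a1 b2 hK0.le (abs_nonneg _)
  have h7 : |X * W - Y * Z| * (K₀ ^ 2 * (1 - α ^ 2)) ≤ |X + a * Y| * |X + b * Y| := by
    calc |X * W - Y * Z| * (K₀ ^ 2 * (1 - α ^ 2))
        = (|X * W - Y * Z| * K₀) * (K₀ * (1 - α ^ 2)) := by ring
      _ ≤ |X| * (K₀ * (1 - α ^ 2)) := mul_le_mul_of_nonneg_right hJ (by positivity)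
      _ ≤ _ := h6
  rw [heq, abs_div, abs_mul, abs_mul, div_le_iff₀ (by positivity), one_div, inv_mul_eq_div,
    div_mul_eq_mul_div, le_div_iff₀ (by positivity)]
  nlinarith [abs_nonneg (a - b)]

/-! ## Unstable manifolds are continuously differentiable -/

/-- The slopes of the short chords of the graph of `g` near `x` are at distance at most `c`
from `a`. -/
def SlopeNear (g : ℝ → ℝ) (x a c : ℝ) : Prop :=
  ∀ᶠ p in 𝓝[Icc (0 : ℝ) 1] x ×ˢ 𝓝[Icc (0 : ℝ) 1] x,
    |g p.1 - g p.2 - a * (p.1 - p.2)| ≤ c * |p.1 - p.2|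

lemma SlopeNear.eventually {g : ℝ → ℝ} {x a c : ℝ} (h : SlopeNear g x a c)
    (hx : x ∈ Icc (0 : ℝ) 1) :
    ∀ᶠ y in 𝓝[Icc (0 : ℝ) 1] x, |g y - g x - a * (y - x)| ≤ c * |y - x| :=
  (tendsto_id.prodMk (tendsto_const_nhdsWithin hx)).eventually h

/-- The reason for admitting chords with both ends free: the estimate passes to base points y near
x, which gives continuity of the derivative. -/
lemma SlopeNear.eventually_eventually {g : ℝ → ℝ} {x a c : ℝ} (h : SlopeNear g x a c) :
    ∀ᶠ y in 𝓝[Icc (0 : ℝ) 1] x, ∀ᶠ s in 𝓝[Icc (0 : ℝ) 1] y,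
      |g s - g y - a * (s - y)| ≤ c * |s - y| := by
  obtain ⟨U, hU, V, hV, hUV⟩ := mem_prod_iff.1 h
  filter_upwards [eventually_mem_nhdsWithin, hV,
    eventually_eventually_nhdsWithin.2 (show ∀ᶠ s in 𝓝[Icc (0 : ℝ) 1] x, s ∈ U from hU)]
    with y _ hyV hyU
  filter_upwards [hyU] with s hs
  exact hUV (mk_mem_prod hs hyV)

lemma abs_sub_le_of_eventually_slope {g : ℝ → ℝ} {x a b c d : ℝ} (hx : x ∈ Icc (0 : ℝ) 1)
    (ha : ∀ᶠ y in 𝓝[Icc (0 : ℝ) 1] x, |g y - g x - a * (y - x)| ≤ c * |y - x|)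
    (hb : ∀ᶠ y in 𝓝[Icc (0 : ℝ) 1] x, |g y - g x - b * (y - x)| ≤ d * |y - x|) :
    |a - b| ≤ c + d := by
  have hacc : (𝓝[Icc (0 : ℝ) 1 \ {x}] x).NeBot :=
    accPt_principal_iff_nhdsWithin.1 ((uniqueDiffOn_Icc (zero_lt_one' ℝ)) x hx).accPt
  have hle : 𝓝[Icc (0 : ℝ) 1 \ {x}] x ≤ 𝓝[Icc (0 : ℝ) 1] x := nhdsWithin_mono _ sdiff_subset
  obtain ⟨y, ⟨h1, h2⟩, hy⟩ := (((ha.filter_mono hle).and (hb.filter_mono hle)).and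
    self_mem_nhdsWithin).exists
  have hpos : 0 < |y - x| := abs_pos.2 (sub_ne_zero.2 hy.2)
  refine le_of_mul_le_mul_right ?_ hpos
  calc |a - b| * |y - x| = |(g y - g x - b * (y - x)) - (g y - g x - a * (y - x))| := by
        rw [← abs_mul]; congr 1; ring
    _ ≤ |g y - g x - b * (y - x)| + |g y - g x - a * (y - x)| := abs_sub _ _
    _ ≤ _ := by linarith

/-- The chords of the graph of `g` near `x` have slopes converging to `a`. -/
def HasSlope (g : ℝ → ℝ) (x a : ℝ) : Prop := ∀ c > 0, SlopeNear g x a c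

lemma HasSlope.hasDerivWithinAt {g : ℝ → ℝ} {x a : ℝ} (h : HasSlope g x a)
    (hx : x ∈ Icc (0 : ℝ) 1) : HasDerivWithinAt g a (Icc 0 1) x := by
  rw [hasDerivWithinAt_iff_isLittleO, Asymptotics.isLittleO_iff]
  intro c hc
  filter_upwards [(h c hc).eventually hx] with y hy
  simpa [mul_comm a] using hy

lemma HasSlope.derivWithin {g : ℝ → ℝ} {x a : ℝ} (h : HasSlope g x a)
    (hx : x ∈ Icc (0 : ℝ) 1) : derivWithin g (Icc 0 1) x = a :=
  (h.hasDerivWithinAt hx).derivWithin (uniqueDiffOn_Icc zero_lt_one x hx)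

/-- Approximate slopes with errors c and d differ by at most c + d, so those with error 1/(n+1) form
a Cauchy sequence; its limit is the slope. -/
lemma exists_hasSlope {g : ℝ → ℝ} {x α : ℝ} (hx : x ∈ Icc (0 : ℝ) 1)
    (h : ∀ c > 0, ∃ a, |a| ≤ α ∧ SlopeNear g x a c) : ∃ a, |a| ≤ α ∧ HasSlope g x a := by
  have hp : ∀ n : ℕ, (0 : ℝ) < 1 / ((n : ℝ) + 1) := fun n => by positivity
  choose a ha hs using fun n : ℕ => h _ (hp n)
  have hlim : Tendsto (fun n : ℕ => 1 / ((n : ℝ) + 1)) atTop (𝓝 0) :=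
    tendsto_one_div_add_atTop_nhds_zero_nat
  have hmono : ∀ {n N : ℕ}, N ≤ n → 1 / ((n : ℝ) + 1) ≤ 1 / ((N : ℝ) + 1) := fun hn => by
    gcongr
  have hc : CauchySeq a := by
    refine cauchySeq_of_le_tendsto_0 (fun N : ℕ => 1 / ((N : ℝ) + 1) + 1 / ((N : ℝ) + 1))
      (fun n m N hn hm => ?_) (by simpa using hlim.add hlim)
    rw [Real.dist_eq]
    exact (abs_sub_le_of_eventually_slope hx ((hs n).eventually hx) ((hs m).eventually hx)).trans
      (add_le_add (hmono hn) (hmono hm))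
  obtain ⟨l, hl⟩ := cauchySeq_tendsto_of_complete hc
  refine ⟨l, le_of_tendsto' hl.abs ha, fun c hc => ?_⟩
  obtain ⟨n, h1, h2⟩ := ((hlim.eventually (gt_mem_nhds (half_pos hc))).and
    (hl.eventually (Metric.ball_mem_nhds l (half_pos hc)))).exists
  rw [Real.dist_eq] at h2
  filter_upwards [hs n] with p hp
  calc |g p.1 - g p.2 - l * (p.1 - p.2)|
      = |(g p.1 - g p.2 - a n * (p.1 - p.2)) + (a n - l) * (p.1 - p.2)| := by congr 1; ring
    _ ≤ |g p.1 - g p.2 - a n * (p.1 - p.2)| + |a n - l| * |p.1 - p.2| := by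
        rw [← abs_mul]; exact abs_add_le _ _
    _ ≤ c / 2 * |p.1 - p.2| + c / 2 * |p.1 - p.2| :=
        add_le_add (hp.trans (mul_le_mul_of_nonneg_right h1.le (abs_nonneg _)))
          (mul_le_mul_of_nonneg_right h2.le (abs_nonneg _))
    _ = _ := by ring

/-- The slope map acts on approximate slopes of unstable manifolds. -/
lemma slopeNear_image (M : HyperbolicModel ι) {α K₀ : ℝ} (hα0 : 0 < α) (hα1 : α < 1)
    (hK : 1 < K₀) (hH : M.Hyperbolic α K₀) {ξ : ℕ → ι} {w : ℝ × ℝ}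
    (hw : w ∈ M.unstableSet fun k => ξ (k + 1)) (hwE : w ∈ M.E (ξ 0)) {a c c' : ℝ}
    (ha : |a| ≤ α) (hs : SlopeNear (M.unstableFun fun k => ξ (k + 1)) w.1 a c)
    (hc : slopeRate α K₀ * c < c') :
    SlopeNear (M.unstableFun ξ) (M.f (ξ 0) w).1 (M.slopeMap (ξ 0) w a) c' := by
  set g := M.unstableFun fun k => ξ (k + 1) with hg
  set h := M.unstableFun ξ with hh
  set x := (M.f (ξ 0) w).1 with hx
  have hfw := (M.mem_unstableSet_iff hα0 hα1 hK hH).1 (M.f_mem_unstableSet hw hwE)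
  have hxI : x ∈ Icc (0 : ℝ) 1 := hfw.1
  have key : ∀ s ∈ Icc (0 : ℝ) 1, ∃ p ∈ M.unstableSet fun k => ξ (k + 1),
      p ∈ M.E (ξ 0) ∧ M.f (ξ 0) p = (s, h s) := fun s hs =>
    M.exists_preimage_of_mem_unstableSet (M.graph_mem_unstableSet hα0 hα1 hK hH ξ hs)
  -- P s is the preimage of the graph point over s. Expansion makes P 1-Lipschitz, so chords near x
  -- pull back to chords near w.
  choose! P hP hPE hfP using key
  have hPx : P x = w := M.injOn_f _ (hPE x hxI) hwE ((hfP x hxI).trans (Prod.ext rfl hfw.2.symm))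
  have hPu : ∀ s ∈ Icc (0 : ℝ) 1, ∀ t ∈ Icc (0 : ℝ) 1, UCone α (P s) (P t) := fun s hs t ht =>
    M.UCone_of_mem_unstableSet hα0 hα1 hK hH (hP s hs) (hP t ht)
  have hPlip : ∀ s ∈ Icc (0 : ℝ) 1, ∀ t ∈ Icc (0 : ℝ) 1, |(P s).1 - (P t).1| ≤ |s - t| := by
    intro s hs t ht
    have := (M.f_UCone hα0 hα1 hK hH (hPE s hs) (hPE t ht) (hPu s hs t ht)).2
    rw [hfP s hs, hfP t ht] at this
    nlinarith [abs_nonneg ((P s).1 - (P t).1)]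
  have hPc : ContinuousOn P (Icc 0 1) := by
    refine LipschitzOnWith.continuousOn (K := 1) (LipschitzOnWith.of_dist_le_mul ?_)
    intro s hs t ht
    rw [dist_eq_norm, norm_sub_eq_of_UCone hα1 (hPu s hs t ht), NNReal.coe_one, one_mul]
    exact hPlip s hs t ht
  set F := 𝓝[Icc (0 : ℝ) 1] x ×ˢ 𝓝[Icc (0 : ℝ) 1] x
  have ht0 : Tendsto P (𝓝[Icc (0 : ℝ) 1] x) (𝓝 w) := by
    have := hPc x hxI
    rwa [ContinuousWithinAt, hPx] at this
  have ht1 : Tendsto (fun p : ℝ × ℝ => (P p.1, P p.2)) F (𝓝 (w, w)) := by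
    rw [nhds_prod_eq]; exact ht0.prodMap ht0
  have ht2 : Tendsto (fun s => (P s).1) (𝓝[Icc (0 : ℝ) 1] x) (𝓝[Icc (0 : ℝ) 1] w.1) := by
    refine tendsto_nhdsWithin_iff.2 ⟨(continuous_fst.tendsto _).comp ht0, ?_⟩
    filter_upwards [self_mem_nhdsWithin] with s hs using (M.E_subset _ (hPE s hs)).1
  have ht3 : Tendsto (fun p : ℝ × ℝ => ((P p.1).1, (P p.2).1)) F
      (𝓝[Icc (0 : ℝ) 1] w.1 ×ˢ 𝓝[Icc (0 : ℝ) 1] w.1) := ht2.prodMap ht2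
  -- Half of the slack: the linearization error enters twice, once in the vertical coordinate and
  -- once in the horizontal one multiplied by the slope B, |B| ≤ 1.
  set e := (c' - slopeRate α K₀ * c) / 2 with he
  have he0 : 0 < e := by rw [he]; linarith
  -- Both ends of the chord move, so differentiability at w must be strict.
  have hstrict := (M.contDiffAt_f hwE).hasStrictFDerivAt (by norm_num)
  have hmem : ∀ᶠ p in F, p.1 ∈ Icc (0 : ℝ) 1 ∧ p.2 ∈ Icc (0 : ℝ) 1 :=
    (prod_mem_prod self_mem_nhdsWithin self_mem_nhdsWithin : _ ∈ F)
  filter_upwards [hmem, ht3.eventually hs, ht1.eventually (hstrict.isLittleO.def he0)]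
    with p hp h1 h2
  obtain ⟨s, t⟩ := p
  obtain ⟨hsI, htI⟩ := hp
  have hu := hPu s hsI t htI
  have hl := hPlip s hsI t htI
  simp only [norm_sub_eq_of_UCone hα1 hu] at h2
  simp only at h1 h2 hsI htI ⊢
  have hgs := ((M.mem_unstableSet_iff hα0 hα1 hK hH).1 (hP s hsI)).2
  have hgt := ((M.mem_unstableSet_iff hα0 hα1 hK hH).1 (hP t htI)).2
  rw [← hg] at hgs hgt
  rw [← hgs, ← hgt] at h1
  rw [hfP s hsI, hfP t htI] at h2
  unfold UCone at hu
  set m := (P s).1 - (P t).1 with hm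
  set n := (P s).2 - (P t).2 with hn
  have hmn : P s - P t = (m, n) := rfl
  rw [hmn] at h2
  set v := fderiv ℝ (M.f (ξ 0)) w (m, n) with hv
  have r1 : |s - t - v.1| ≤ e * |m| := (norm_fst_le _).trans h2
  have r2 : |h s - h t - v.2| ≤ e * |m| := (norm_snd_le _).trans h2
  by_cases hm0 : m = 0
  · rw [hm0, abs_zero, mul_zero] at hu r1 r2
    have hn0 : n = 0 := abs_nonpos_iff.1 hu
    have hv0 : v = 0 := by rw [hv, hm0, hn0, Prod.mk_zero_zero, map_zero]
    rw [hv0] at r1 r2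
    have q1 : s - t = 0 := by simpa using r1
    have q2 : h s - h t = 0 := by simpa using r2
    rw [q1, q2]; simp
  set b := n / m with hb
  have hnb : n = b * m := (div_mul_cancel₀ n hm0).symm
  have hmpos : 0 < |m| := abs_pos.2 hm0
  have hbα : |b| ≤ α := by rw [hb, abs_div, div_le_iff₀ hmpos]; exact hu
  have hba : |b - a| ≤ c := by
    rw [hnb, ← sub_mul, abs_mul] at h1
    exact le_of_mul_le_mul_right h1 hmpos
  have hvb : v = m • fderiv ℝ (M.f (ξ 0)) w (1, b) := by
    rw [hv, ← map_smul, hnb]; congr 1; ext <;> simp [mul_comm]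
  have hD : (fderiv ℝ (M.f (ξ 0)) w (1, b)).1 ≠ 0 :=
    abs_pos.1 (by linarith [(M.fderiv_one_bounds hα0 hH hwE hbα).2.1])
  have hv2 : v.2 = M.slopeMap (ξ 0) w b * v.1 := by
    rw [hvb, slopeMap]; simp only [Prod.smul_fst, Prod.smul_snd, smul_eq_mul]; field_simp
  have hA := M.abs_slopeMap_sub_le hα0 hα1 hK hH hwE hbα ha
  have hAb := M.abs_slopeMap_le hα0 hK hH hwE hbα
  set A := M.slopeMap (ξ 0) w a
  set B := M.slopeMap (ξ 0) w b
  have hκ := (slopeRate_pos hα0 hα1 hK).le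
  have hBA : |B - A| ≤ slopeRate α K₀ * c := hA.trans (mul_le_mul_of_nonneg_left hba hκ)
  calc |h s - h t - A * (s - t)|
      = |(B - A) * (s - t) + ((h s - h t - v.2) - B * (s - t - v.1))| := by
        rw [hv2]; congr 1; ring
    _ ≤ |B - A| * |s - t| + (|h s - h t - v.2| + |B| * |s - t - v.1|) := by
        rw [← abs_mul, ← abs_mul]
        exact (abs_add_le _ _).trans (add_le_add le_rfl (abs_sub _ _))
    _ ≤ slopeRate α K₀ * c * |s - t| + (e * |s - t| + 1 * (e * |s - t|)) := by
        have hes : e * |m| ≤ e * |s - t| := mul_le_mul_of_nonneg_left hl he0.le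
        gcongr
        · exact r2.trans hes
        · linarith
        · exact r1.trans hes
    _ = c' * |s - t| := by rw [he]; ring

/-- Start n steps in the past with slope 0, where the Lipschitz bound is an error α. Each
application of `slopeNear_image` multiplies the error by `slopeRate`, up to an arbitrarily small
loss. -/
lemma exists_slopeNear (M : HyperbolicModel ι) {α K₀ : ℝ} (hα0 : 0 < α) (hα1 : α < 1)
    (hK : 1 < K₀) (hH : M.Hyperbolic α K₀) (n : ℕ) (ξ : ℕ → ι) {x : ℝ} (hx : x ∈ Icc (0 : ℝ) 1)
    {c : ℝ} (hc : slopeRate α K₀ ^ n * α < c) :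
    ∃ a, |a| ≤ α ∧ SlopeNear (M.unstableFun ξ) x a c := by
  induction n generalizing ξ x c with
  | zero =>
    refine ⟨0, by simpa using hα0.le, ?_⟩
    have hmem : ∀ᶠ p in 𝓝[Icc (0 : ℝ) 1] x ×ˢ 𝓝[Icc (0 : ℝ) 1] x,
        p.1 ∈ Icc (0 : ℝ) 1 ∧ p.2 ∈ Icc (0 : ℝ) 1 :=
      prod_mem_prod self_mem_nhdsWithin self_mem_nhdsWithin
    filter_upwards [hmem] with p hp
    have := (M.lipGraph_unstableFun hα0 hα1 hK hH ξ).lip _ hp.1 _ hp.2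
    rw [zero_mul, sub_zero]
    exact this.trans (mul_le_mul_of_nonneg_right (by simpa using hc.le) (abs_nonneg _))
  | succ n ih =>
    have hκ := slopeRate_pos hα0 hα1 hK
    have h1 : slopeRate α K₀ ^ n * α < c / slopeRate α K₀ := by
      rw [lt_div_iff₀ hκ]; rw [pow_succ] at hc; linarith
    obtain ⟨d, hd1, hd2⟩ := exists_between h1
    rw [lt_div_iff₀ hκ] at hd2
    obtain ⟨w, hw, hwE, hfw⟩ := M.exists_preimage_of_mem_unstableSet
      (M.graph_mem_unstableSet hα0 hα1 hK hH ξ hx)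
    obtain ⟨a, ha, has⟩ := ih (fun k => ξ (k + 1)) (M.unstableSet_subset _ hw).1 hd1
    refine ⟨M.slopeMap (ξ 0) w a, M.abs_slopeMap_le hα0 hK hH hwE ha, ?_⟩
    have := M.slopeNear_image hα0 hα1 hK hH hw hwE ha has (c' := c) (by linarith)
    rwa [hfw] at this

/-- The slope of the unstable manifold with past `ξ` over the abscissa `x`. -/
def uSlope (M : HyperbolicModel ι) (ξ : ℕ → ι) (x : ℝ) : ℝ :=
  derivWithin (M.unstableFun ξ) (Icc 0 1) x

lemma hasSlope_unstableFun (M : HyperbolicModel ι) {α K₀ : ℝ} (hα0 : 0 < α) (hα1 : α < 1)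
    (hK : 1 < K₀) (hH : M.Hyperbolic α K₀) (h5 : 1 / K₀ ^ 2 + α ^ 2 < 1) (ξ : ℕ → ι) {x : ℝ}
    (hx : x ∈ Icc (0 : ℝ) 1) :
    |M.uSlope ξ x| ≤ α ∧ HasSlope (M.unstableFun ξ) x (M.uSlope ξ x) := by
  obtain ⟨a, ha, h⟩ := exists_hasSlope (g := M.unstableFun ξ) (α := α) hx fun c hc => by
    have hlim : Tendsto (fun n : ℕ => slopeRate α K₀ ^ n * α) atTop (𝓝 (0 * α)) :=
      (tendsto_pow_atTop_nhds_zero_of_lt_one (slopeRate_pos hα0 hα1 hK).le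
        (slopeRate_lt_one hα0 hα1 hK h5)).mul_const α
    rw [zero_mul] at hlim
    obtain ⟨n, hn⟩ := (hlim.eventually (gt_mem_nhds hc)).exists
    exact M.exists_slopeNear hα0 hα1 hK hH n ξ hx hn
  have : M.uSlope ξ x = a := h.derivWithin hx
  rw [this]
  exact ⟨ha, h⟩

lemma contDiffOn_unstableFun (M : HyperbolicModel ι) {α K₀ : ℝ} (hα0 : 0 < α) (hα1 : α < 1)
    (hK : 1 < K₀) (hH : M.Hyperbolic α K₀) (h5 : 1 / K₀ ^ 2 + α ^ 2 < 1) (ξ : ℕ → ι) :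
    ContDiffOn ℝ 1 (M.unstableFun ξ) (Icc 0 1) := by
  have hs := fun x (hx : x ∈ Icc (0 : ℝ) 1) =>
    (M.hasSlope_unstableFun hα0 hα1 hK hH h5 ξ hx).2
  rw [contDiffOn_one_iff_derivWithin (uniqueDiffOn_Icc zero_lt_one)]
  refine ⟨fun x hx => ((hs x hx).hasDerivWithinAt hx).differentiableWithinAt, ?_⟩
  intro x hx
  refine Metric.tendsto_nhds.2 fun ε hε => ?_
  filter_upwards [(hs x hx (ε / 3) (by positivity)).eventually_eventually,
    self_mem_nhdsWithin] with y hy hyI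
  rw [dist_comm, Real.dist_eq]
  have := abs_sub_le_of_eventually_slope hyI hy
    (((hs y hyI) (ε / 3) (by positivity)).eventually hyI)
  exact this.trans_lt (by linarith)

lemma uSlope_image (M : HyperbolicModel ι) {α K₀ : ℝ} (hα0 : 0 < α) (hα1 : α < 1)
    (hK : 1 < K₀) (hH : M.Hyperbolic α K₀) (h5 : 1 / K₀ ^ 2 + α ^ 2 < 1) {ξ : ℕ → ι}
    {w : ℝ × ℝ} (hw : w ∈ M.unstableSet fun k => ξ (k + 1)) (hwE : w ∈ M.E (ξ 0)) :
    M.uSlope ξ (M.f (ξ 0) w).1 =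
      M.slopeMap (ξ 0) w (M.uSlope (fun k => ξ (k + 1)) w.1) := by
  obtain ⟨h1, h2⟩ := M.hasSlope_unstableFun hα0 hα1 hK hH h5 (fun k => ξ (k + 1))
    (M.unstableSet_subset _ hw).1
  have hκ := slopeRate_pos hα0 hα1 hK
  refine HasSlope.derivWithin (fun c hc => ?_) (M.mapsTo_unitSquare _ hwE).1
  refine M.slopeNear_image hα0 hα1 hK hH hw hwE h1 (h2 (c / (2 * slopeRate α K₀)) (by positivity)) ?_
  have : slopeRate α K₀ * (c / (2 * slopeRate α K₀)) = c / 2 := by field_simp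
  linarith

lemma unstableSlope_eq (M : HyperbolicModel ι) (ω : ℤ → ι) :
    M.unstableSlope ω = M.uSlope (past ω) (M.point ω).1 := rfl

lemma abs_unstableSlope_le (M : HyperbolicModel ι) {α K₀ : ℝ} (hα0 : 0 < α) (hα1 : α < 1)
    (hK : 1 < K₀) (hH : M.Hyperbolic α K₀) (h5 : 1 / K₀ ^ 2 + α ^ 2 < 1) (ω : ℤ → ι) :
    |M.unstableSlope ω| ≤ α :=
  (M.hasSlope_unstableFun hα0 hα1 hK hH h5 _
    (M.unstableSet_subset _ (M.point_mem hα0 hα1 hK hH ω).2).1).1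

lemma unstableSlope_shift (M : HyperbolicModel ι) {α K₀ : ℝ} (hα0 : 0 < α) (hα1 : α < 1)
    (hK : 1 < K₀) (hH : M.Hyperbolic α K₀) (h5 : 1 / K₀ ^ 2 + α ^ 2 < 1) (ω : ℤ → ι) :
    M.unstableSlope (shift ω) = M.slopeMap (ω 0) (M.point ω) (M.unstableSlope ω) := by
  have hp := (M.point_mem hα0 hα1 hK hH ω).2
  rw [unstableSlope_eq, unstableSlope_eq, ← M.f_point hα0 hα1 hK hH]
  have := M.uSlope_image hα0 hα1 hK hH h5 (ξ := past (shift ω)) (w := M.point ω)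
    (by rw [past_shift_succ]; exact hp)
    (by rw [past_shift_zero]; exact M.point_mem_E hα0 hα1 hK hH ω)
  rwa [past_shift_succ, past_shift_zero] at this

/-! ## Distortion -/

/-- `z` and `w` are joined within `A` by a curve of length at most `‖z - w‖`. -/
def LipJoined (A : Set (ℝ × ℝ)) (z w : ℝ × ℝ) : Prop :=
  ∃ γ : ℝ → ℝ × ℝ, γ 0 = z ∧ γ 1 = w ∧ (∀ t ∈ Icc (0 : ℝ) 1, γ t ∈ A) ∧
    ∀ s ∈ Icc (0 : ℝ) 1, ∀ t ∈ Icc (0 : ℝ) 1, ‖γ s - γ t‖ ≤ ‖z - w‖ * |s - t|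

lemma LipJoined.mem {A : Set (ℝ × ℝ)} {z w : ℝ × ℝ} (h : LipJoined A z w) : z ∈ A ∧ w ∈ A := by
  obtain ⟨γ, rfl, rfl, hA, -⟩ := h
  exact ⟨hA 0 (by simp), hA 1 (by simp)⟩

/-- A mean value inequality along Lipschitz curves. The derivative bounds hold only on `E_i`, and
stable manifolds are available only as Lipschitz curves. -/
lemma LipJoined.abs_sub_le {A : Set (ℝ × ℝ)} {z w : ℝ × ℝ} (h : LipJoined A z w)
    {G : ℝ × ℝ → ℝ} {C : ℝ}
    (hG : ∀ p ∈ A, ∃ G' : ℝ × ℝ →L[ℝ] ℝ, HasFDerivAt G G' p ∧ ∀ u, |G' u| ≤ C * ‖u‖) :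
    |G z - G w| ≤ C * ‖z - w‖ := by
  obtain ⟨γ, h0, h1, hA, hγ⟩ := h
  set L := ‖z - w‖ with hL
  have hL0 : 0 ≤ L := norm_nonneg _
  have hγc : ContinuousOn γ (Icc 0 1) := by
    refine LipschitzOnWith.continuousOn (K := ⟨L, hL0⟩) (LipschitzOnWith.of_dist_le_mul ?_)
    intro s hs t ht
    rw [dist_eq_norm, Real.dist_eq]
    exact hγ s hs t ht
  have hGc : ContinuousOn (fun t => G (γ t)) (Icc 0 1) := by
    intro t ht
    obtain ⟨G', hG', -⟩ := hG _ (hA t ht)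
    exact hG'.continuousAt.comp_continuousWithinAt (hγc t ht)
  have key := norm_sub_le_of_pointwise' (C := C * L) hGc (fun t ht ε hε => ?_)
    (left_mem_Icc.2 zero_le_one) (right_mem_Icc.2 zero_le_one)
  · simpa [h0, h1] using key
  obtain ⟨G', hG', hC⟩ := hG _ (hA t ht)
  have he : 0 < ε / (L + 1) := by positivity
  filter_upwards [(hγc t ht).tendsto.eventually (hG'.isLittleO.def he), self_mem_nhdsWithin]
    with s hs hsI
  have h2 := hγ s hsI t ht
  have h3 := hC (γ s - γ t)
  rw [Real.norm_eq_abs] at hs ⊢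
  have hC0 : 0 ≤ C := by
    have := (abs_nonneg _).trans (hC (1, 1))
    simpa [Prod.norm_def] using this
  have h4 : |G (γ s) - G (γ t)| ≤ (C + ε / (L + 1)) * ‖γ s - γ t‖ := by
    have := abs_add_le (G (γ s) - G (γ t) - G' (γ s - γ t)) (G' (γ s - γ t))
    rw [sub_add_cancel] at this
    linarith
  have h5 : ε / (L + 1) * L ≤ ε := by
    rw [div_mul_eq_mul_div, div_le_iff₀ (by positivity)]; nlinarith
  calc |G (γ s) - G (γ t)| ≤ (C + ε / (L + 1)) * ‖γ s - γ t‖ := h4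
    _ ≤ (C + ε / (L + 1)) * (L * |s - t|) := mul_le_mul_of_nonneg_left h2 (by positivity)
    _ = (C * L + ε / (L + 1) * L) * |s - t| := by ring
    _ ≤ (C * L + ε) * |s - t| := mul_le_mul_of_nonneg_right (by linarith) (abs_nonneg _)

lemma lipJoined_of_UCone (M : HyperbolicModel ι) {α K₀ : ℝ} (hα0 : 0 < α) (hα1 : α < 1)
    (hK : 1 < K₀) (hH : M.Hyperbolic α K₀) {i : ι} {z w : ℝ × ℝ} (hz : z ∈ M.E i)
    (hw : w ∈ M.E i) (hu : UCone α z w) : LipJoined (M.E i) z w := by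
  refine ⟨seg z w, by simp [seg], by simp [seg],
    fun t ht => M.seg_mem_E hα0 hα1 hK hH hz hw hu ht, fun s _ t _ => ?_⟩
  have : seg z w s - seg z w t = (s - t) • (w - z) := by simp only [seg]; module
  rw [this, norm_smul, norm_sub_rev w, Real.norm_eq_abs, mul_comm]

/-- The curve is the stable manifold itself, with height as an affine parameter; the straight
segment need not stay in `E_i`. -/
lemma lipJoined_of_mem_stableSet (M : HyperbolicModel ι) {α K₀ : ℝ} (hα0 : 0 < α) (hα1 : α < 1)
    (hK : 1 < K₀) (hH : M.Hyperbolic α K₀) {x : ℕ → ι} {z w : ℝ × ℝ} (hz : z ∈ M.stableSet x)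
    (hw : w ∈ M.stableSet x) : LipJoined (M.E (x 0)) z w := by
  choose! s hs using fun y (hy : y ∈ Icc (0 : ℝ) 1) => M.exists_mem_stableSet hα0 hα1 hK hH x hy
  have hcone := fun {p q} (hp : p ∈ M.stableSet x) (hq : q ∈ M.stableSet x) =>
    M.SCone_of_mem_stableSet hα0 hα1 hK hH hp hq
  have huniq : ∀ p ∈ M.stableSet x, (s p.2, p.2) = p := by
    intro p hp
    refine eq_of_UCone_of_SCone hα1 ?_ (hcone (hs _ (M.stableSet_subset x hp).2) hp)
    unfold UCone; simpa using mul_nonneg hα0.le (abs_nonneg _)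
  have hzI := (M.stableSet_subset x hz).2
  have hwI := (M.stableSet_subset x hw).2
  have hI : ∀ t ∈ Icc (0 : ℝ) 1, z.2 + t * (w.2 - z.2) ∈ Icc (0 : ℝ) 1 := fun t ht =>
    ⟨by nlinarith [ht.1, ht.2, hzI.1, hwI.1], by nlinarith [ht.1, ht.2, hzI.2, hwI.2]⟩
  refine ⟨fun t => (s (z.2 + t * (w.2 - z.2)), z.2 + t * (w.2 - z.2)), ?_, ?_, ?_, ?_⟩
  · simpa using huniq z hz
  · simpa using huniq w hw
  · exact fun t ht => M.mem_E_of_mem_stableSet (hs _ (hI t ht))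
  · intro a ha b hb
    rw [norm_sub_eq_of_SCone hα1 (hcone (hs _ (hI a ha)) (hs _ (hI b hb)))]
    have : z.2 + a * (w.2 - z.2) - (z.2 + b * (w.2 - z.2)) = (w - z).2 * (a - b) := by
      rw [Prod.snd_sub]; ring
    rw [this, abs_mul, norm_sub_rev]
    exact mul_le_mul_of_nonneg_right (norm_snd_le (w - z)) (abs_nonneg _)

/-- H1 identifies the norm of ∂F/∂x with |F₁ₓ|, so D2 bounds every second partial by C₀|F₁ₓ|. The
factor 4 counts the terms of D²F(u, (1, a)), with |a| ≤ 1. -/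
lemma exists_hasFDerivAt_fderiv (M : HyperbolicModel ι) {α K₀ C₀ : ℝ} (hα0 : 0 < α) (hα1 : α < 1)
    (hK : 1 < K₀) (hH : M.Hyperbolic α K₀) (hD : M.Distortion C₀) {i : ι} {z : ℝ × ℝ}
    (hz : z ∈ M.E i) {a : ℝ} (ha : |a| ≤ α) :
    ∃ G' : ℝ × ℝ →L[ℝ] ℝ × ℝ, HasFDerivAt (fun p => fderiv ℝ (M.f i) p (1, a)) G' z ∧
      ∀ u, ‖G' u‖ ≤ 4 * (C₀ * |(partialX (M.f i) z).1|) * ‖u‖ := by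
  have h2 := M.contDiffAt_f hz
  have hB : HasFDerivAt (fderiv ℝ (M.f i)) (fderiv ℝ (fderiv ℝ (M.f i)) z) z :=
    ((h2.fderiv_right (m := 1) (by norm_num)).differentiableAt (by norm_num)).hasFDerivAt
  have hsymm : IsSymmSndFDerivAt ℝ (M.f i) z := h2.isSymmSndFDerivAt (by simp)
  set B := fderiv ℝ (fderiv ℝ (M.f i)) z
  have hv : ∀ v, HasFDerivAt (fun p => fderiv ℝ (M.f i) p v) (B.flip v) z := fun v => by
    have := hB.clm_apply (hasFDerivAt_const v z)
    exact this.congr_fderiv (by simp)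
  refine ⟨B.flip (1, a), hv _, fun u => ?_⟩
  have hXX : partialX (partialX (M.f i)) z = B (1, 0) (1, 0) := by
    have : partialX (M.f i) = fun p => fderiv ℝ (M.f i) p (1, 0) := rfl
    rw [partialX, this, (hv _).fderiv]; rfl
  have hXY : partialY (partialX (M.f i)) z = B (0, 1) (1, 0) := by
    have : partialX (M.f i) = fun p => fderiv ℝ (M.f i) p (1, 0) := rfl
    rw [partialY, this, (hv _).fderiv]; rfl
  have hYY : partialY (partialY (M.f i)) z = B (0, 1) (0, 1) := by
    have : partialY (M.f i) = fun p => fderiv ℝ (M.f i) p (0, 1) := rfl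
    rw [partialY, this, (hv _).fderiv]; rfl
  have hYX : B (1, 0) (0, 1) = B (0, 1) (1, 0) := hsymm _ _
  have hX1 : 0 < |(partialX (M.f i) z).1| := by
    have := hH.h2 i z hz
    have : 0 ≤ α * |(partialY (M.f i) z).1| := by positivity
    linarith
  have hnorm : ‖partialX (M.f i) z‖ = |(partialX (M.f i) z).1| := by
    rw [Prod.norm_def]
    refine max_eq_left ((M.abs_partials_le hα0 hH hz).1.trans ?_)
    exact mul_le_of_le_one_left (abs_nonneg _) hα1.le
  have hS := hD i z hz
  rw [hnorm, div_lt_iff₀ hX1, secondDerivMax, hXX, hXY, hYY] at hS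
  set S := C₀ * |(partialX (M.f i) z).1|
  have s1 : ‖B (1, 0) (1, 0)‖ ≤ S := (le_max_left _ _).trans hS.le
  have s2 : ‖B (0, 1) (1, 0)‖ ≤ S := ((le_max_left _ _).trans (le_max_right _ _)).trans hS.le
  have s3 : ‖B (0, 1) (0, 1)‖ ≤ S := ((le_max_right _ _).trans (le_max_right _ _)).trans hS.le
  have hexp : B.flip (1, a) u = u.1 • (B (1, 0) (1, 0) + a • B (0, 1) (1, 0)) +
      u.2 • (B (0, 1) (1, 0) + a • B (0, 1) (0, 1)) := by
    have e1 : u = u.1 • ((1, 0) : ℝ × ℝ) + u.2 • ((0, 1) : ℝ × ℝ) := by ext <;> simp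
    have e2 : ((1, a) : ℝ × ℝ) = (1, 0) + a • (0, 1) := by ext <;> simp
    rw [ContinuousLinearMap.flip_apply]
    conv_lhs => rw [e1, e2]
    simp only [map_add, map_smul, add_apply, smul_apply, hYX]
    module
  have hS0 : 0 ≤ S := (norm_nonneg _).trans s1
  have ha1 : |a| ≤ 1 := ha.trans hα1.le
  have t1 : ∀ p q : ℝ × ℝ, ‖p‖ ≤ S → ‖q‖ ≤ S → ‖p + a • q‖ ≤ 2 * S := by
    intro p q hp hq
    calc ‖p + a • q‖ ≤ ‖p‖ + ‖a • q‖ := norm_add_le _ _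
      _ = ‖p‖ + |a| * ‖q‖ := by rw [norm_smul, Real.norm_eq_abs]
      _ ≤ S + 1 * S := by gcongr
      _ = 2 * S := by ring
  rw [hexp]
  calc _ ≤ ‖u.1 • (B (1, 0) (1, 0) + a • B (0, 1) (1, 0))‖ +
        ‖u.2 • (B (0, 1) (1, 0) + a • B (0, 1) (0, 1))‖ := norm_add_le _ _
    _ ≤ ‖u‖ * (2 * S) + ‖u‖ * (2 * S) := by
        rw [norm_smul, norm_smul]
        gcongr
        · exact norm_fst_le u
        · exact t1 _ _ s1 s2
        · exact norm_snd_le u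
        · exact t1 _ _ s2 s3
    _ = _ := by ring

/-- The Lipschitz constant of the slope maps and of the logarithmic expansion. -/
def distortionConst (α C₀ : ℝ) : ℝ := 8 * C₀ / (1 - α ^ 2)

lemma distortionConst_pos {α C₀ : ℝ} (hα0 : 0 < α) (hα1 : α < 1) (hC : 0 < C₀) :
    0 < distortionConst α C₀ := by
  have : 0 < 1 - α ^ 2 := by nlinarith
  unfold distortionConst; positivity

/-- The 8 is twice the 4 of `exists_hasFDerivAt_fderiv`, because the derivative of the quotient N/D
in `slopeMap` has two such terms. -/
lemma div_fst_fderiv_le (M : HyperbolicModel ι) {α K₀ C₀ : ℝ} (hα0 : 0 < α) (hα1 : α < 1)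
    (hH : M.Hyperbolic α K₀) (hC : 0 < C₀) {i : ι} {z : ℝ × ℝ}
    (hz : z ∈ M.E i) {a : ℝ} (ha : |a| ≤ α) :
    8 * (C₀ * |(partialX (M.f i) z).1|) ≤
      distortionConst α C₀ * |(fderiv ℝ (M.f i) z (1, a)).1| := by
  have h1α : 0 < 1 - α ^ 2 := by nlinarith
  have h := (M.fderiv_one_bounds hα0 hH hz ha).1
  unfold distortionConst
  rw [div_mul_eq_mul_div, le_div_iff₀ h1α]
  nlinarith

/-- In the logarithmic derivative, D2 bounds the numerator by a multiple of |F₁ₓ| and the cone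
bounds the denominator from below by another; |F₁ₓ| cancels, so the constant is uniform in i. -/
lemma abs_log_sub_le (M : HyperbolicModel ι) {α K₀ C₀ : ℝ} (hα0 : 0 < α) (hα1 : α < 1)
    (hK : 1 < K₀) (hH : M.Hyperbolic α K₀) (hC : 0 < C₀) (hD : M.Distortion C₀) {i : ι}
    {z w : ℝ × ℝ} (h : LipJoined (M.E i) z w) {a : ℝ} (ha : |a| ≤ α) :
    |Real.log (fderiv ℝ (M.f i) z (1, a)).1 - Real.log (fderiv ℝ (M.f i) w (1, a)).1| ≤
      distortionConst α C₀ * ‖z - w‖ := by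
  refine h.abs_sub_le (G := fun p => Real.log (fderiv ℝ (M.f i) p (1, a)).1) fun p hp => ?_
  obtain ⟨G', hG', hb⟩ := M.exists_hasFDerivAt_fderiv hα0 hα1 hK hH hD hp ha
  have hX := M.div_fst_fderiv_le hα0 hα1 hH hC hp ha
  have hpos : 0 < |(fderiv ℝ (M.f i) p (1, a)).1| := by
    linarith [(M.fderiv_one_bounds hα0 hH hp ha).2.1]
  refine ⟨_, hG'.fst.log (abs_pos.1 hpos), fun u => ?_⟩
  have h1 : |(G' u).1| ≤ _ := (norm_fst_le _).trans (hb u)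
  have hu := norm_nonneg u
  have hS : 0 ≤ C₀ * |(partialX (M.f i) p).1| := by positivity
  simp only [smul_apply, ContinuousLinearMap.comp_apply,
    ContinuousLinearMap.coe_fst', smul_eq_mul]
  rw [abs_mul, abs_inv, inv_mul_le_iff₀ hpos]
  nlinarith

lemma abs_slopeMap_sub_le_of_joined (M : HyperbolicModel ι) {α K₀ C₀ : ℝ} (hα0 : 0 < α)
    (hα1 : α < 1) (hK : 1 < K₀) (hH : M.Hyperbolic α K₀) (hC : 0 < C₀) (hD : M.Distortion C₀)
    {i : ι} {z w : ℝ × ℝ} (h : LipJoined (M.E i) z w) {a : ℝ} (ha : |a| ≤ α) :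
    |M.slopeMap i z a - M.slopeMap i w a| ≤ distortionConst α C₀ * ‖z - w‖ := by
  refine h.abs_sub_le (G := fun p => M.slopeMap i p a) fun p hp => ?_
  obtain ⟨G', hG', hb⟩ := M.exists_hasFDerivAt_fderiv hα0 hα1 hK hH hD hp ha
  have hX := M.div_fst_fderiv_le hα0 hα1 hH hC hp ha
  obtain ⟨-, h2, h3⟩ := M.fderiv_one_bounds hα0 hH hp ha
  have hpos : 0 < |(fderiv ℝ (M.f i) p (1, a)).1| := by linarith
  have hder : HasFDerivAt (fun p => M.slopeMap i p a) _ p :=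
    hG'.snd.mul ((hasDerivAt_inv (abs_pos.1 hpos)).comp_hasFDerivAt p hG'.fst)
  refine ⟨_, hder, fun u => ?_⟩
  have g1 : |(G' u).1| ≤ _ := (norm_fst_le _).trans (hb u)
  have g2 : |(G' u).2| ≤ _ := (norm_snd_le _).trans (hb u)
  have hu := norm_nonneg u
  simp only [smul_apply, ContinuousLinearMap.comp_apply, add_apply, ContinuousLinearMap.coe_fst',
    ContinuousLinearMap.coe_snd', smul_eq_mul]
  set D := (fderiv ℝ (M.f i) p (1, a)).1
  set N := (fderiv ℝ (M.f i) p (1, a)).2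
  set S := C₀ * |(partialX (M.f i) p).1|
  have hS : 0 ≤ S := by positivity
  have hD0 : D ≠ 0 := abs_pos.1 hpos
  have heq : N * (-(D ^ 2)⁻¹ * (G' u).1) + D⁻¹ * (G' u).2 =
      D⁻¹ * ((G' u).2 - N * D⁻¹ * (G' u).1) := by field_simp; ring
  have hND : |N * D⁻¹| ≤ 1 := by
    rw [abs_mul, abs_inv, ← div_eq_mul_inv, div_le_one hpos]
    exact h3.trans (mul_le_of_le_one_left hpos.le hα1.le)
  have h4 : |(G' u).2 - N * D⁻¹ * (G' u).1| ≤ 8 * S * ‖u‖ := by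
    have := abs_sub (G' u).2 (N * D⁻¹ * (G' u).1)
    rw [abs_mul] at this
    have h5 : |N * D⁻¹| * |(G' u).1| ≤ |(G' u).1| := mul_le_of_le_one_left (abs_nonneg _) hND
    linarith
  rw [heq, abs_mul, abs_inv, inv_mul_le_iff₀ hpos]
  nlinarith

/-- The logarithmic expansion is Lipschitz in the slope. -/
lemma log_fst_fderiv_sub_le (M : HyperbolicModel ι) {α K₀ : ℝ} (hα0 : 0 < α) (hα1 : α < 1)
    (hK : 1 < K₀) (hH : M.Hyperbolic α K₀) {i : ι} {z : ℝ × ℝ} (hz : z ∈ M.E i) {a b : ℝ}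
    (ha : |a| ≤ α) (hb : |b| ≤ α) :
    Real.log (fderiv ℝ (M.f i) z (1, a)).1 - Real.log (fderiv ℝ (M.f i) z (1, b)).1 ≤
      1 / (1 - α ^ 2) * |a - b| := by
  have h1α : 0 < 1 - α ^ 2 := by nlinarith
  obtain ⟨-, a2, -⟩ := M.fderiv_one_bounds hα0 hH hz ha
  obtain ⟨b1, b2, -⟩ := M.fderiv_one_bounds hα0 hH hz hb
  have hY := (M.abs_partials_le hα0 hH hz).2
  have hdiff : (fderiv ℝ (M.f i) z (1, a)).1 - (fderiv ℝ (M.f i) z (1, b)).1 =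
      (a - b) * (partialY (M.f i) z).1 := by
    rw [fderiv_one_apply, fderiv_one_apply]
    simp only [Prod.fst_add, Prod.smul_fst, smul_eq_mul]; ring
  rw [← Real.log_abs, ← Real.log_abs (fderiv ℝ (M.f i) z (1, b)).1]
  set A := (fderiv ℝ (M.f i) z (1, a)).1
  set B := (fderiv ℝ (M.f i) z (1, b)).1
  have hA : 0 < |A| := by linarith
  have hB : 0 < |B| := by linarith
  -- Use log t ≤ t - 1 at t = |A|/|B|, where A - B = (a - b)F₁ᵧ and |F₁ᵧ| ≤ |B|/(1-α²).
  rw [← Real.log_div hA.ne' hB.ne']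
  refine (Real.log_le_sub_one_of_pos (by positivity)).trans ?_
  have h3 : |A| - |B| ≤ |a - b| * |(partialY (M.f i) z).1| := by
    rw [← abs_mul, ← hdiff]; exact abs_sub_abs_le_abs_sub A B
  have h4 : (1 - α ^ 2) * |(partialY (M.f i) z).1| ≤ |B| := by
    refine le_trans ?_ b1
    exact mul_le_mul_of_nonneg_left
      (hY.trans (mul_le_of_le_one_left (abs_nonneg _) hα1.le)) h1α.le
  rw [div_sub_one hB.ne', div_le_iff₀ hB, one_div, inv_mul_eq_div, div_mul_eq_mul_div,
    le_div_iff₀ h1α]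
  nlinarith [abs_nonneg (a - b)]

/-- The image vector lies in the unstable cone, so its max norm is the modulus of its first
coordinate. The sign is immaterial because `Real.log` is even. -/
lemma phi_eq (M : HyperbolicModel ι) {α K₀ : ℝ} (hα0 : 0 < α) (hα1 : α < 1)
    (hK : 1 < K₀) (hH : M.Hyperbolic α K₀) (h5 : 1 / K₀ ^ 2 + α ^ 2 < 1) (ω : ℤ → ι) :
    M.phi ω = -Real.log (fderiv ℝ (M.f (ω 0)) (M.point ω) (1, M.unstableSlope ω)).1 := by
  obtain ⟨-, -, h⟩ := M.fderiv_one_bounds hα0 hH (M.point_mem_E hα0 hα1 hK hH ω)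
    (M.abs_unstableSlope_le hα0 hα1 hK hH h5 ω)
  rw [phi, unstableDeriv, Prod.norm_def, max_eq_left, Real.norm_eq_abs, Real.log_abs]
  exact h.trans (mul_le_of_le_one_left (abs_nonneg _) hα1.le)

lemma abs_phi_sub_le (M : HyperbolicModel ι) {α K₀ C₀ : ℝ} (hα0 : 0 < α) (hα1 : α < 1)
    (hK : 1 < K₀) (hH : M.Hyperbolic α K₀) (h5 : 1 / K₀ ^ 2 + α ^ 2 < 1) (hC : 0 < C₀)
    (hD : M.Distortion C₀) {ω ω' : ℤ → ι} (h0 : ω 0 = ω' 0)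
    (h : LipJoined (M.E (ω 0)) (M.point ω) (M.point ω')) :
    |M.phi ω - M.phi ω'| ≤ distortionConst α C₀ * ‖M.point ω - M.point ω'‖ +
      1 / (1 - α ^ 2) * |M.unstableSlope ω - M.unstableSlope ω'| := by
  have ha := M.abs_unstableSlope_le hα0 hα1 hK hH h5 ω
  have hb := M.abs_unstableSlope_le hα0 hα1 hK hH h5 ω'
  rw [M.phi_eq hα0 hα1 hK hH h5, M.phi_eq hα0 hα1 hK hH h5, ← h0]
  have e1 := abs_le.1 (M.abs_log_sub_le hα0 hα1 hK hH hC hD h ha)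
  have e2 := M.log_fst_fderiv_sub_le hα0 hα1 hK hH h.mem.2 ha hb
  have e3 := M.log_fst_fderiv_sub_le hα0 hα1 hK hH h.mem.2 hb ha
  rw [abs_sub_comm] at e3
  exact abs_le.2 ⟨by linarith [e1.1, e1.2], by linarith [e1.1, e1.2]⟩

lemma abs_slopeMap_sub_slopeMap_le (M : HyperbolicModel ι) {α K₀ C₀ : ℝ} (hα0 : 0 < α)
    (hα1 : α < 1) (hK : 1 < K₀) (hH : M.Hyperbolic α K₀) (hC : 0 < C₀) (hD : M.Distortion C₀)
    {i : ι} {z w : ℝ × ℝ} (h : LipJoined (M.E i) z w) {a b : ℝ} (ha : |a| ≤ α) (hb : |b| ≤ α) :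
    |M.slopeMap i z a - M.slopeMap i w b| ≤
      slopeRate α K₀ * |a - b| + distortionConst α C₀ * ‖z - w‖ := by
  have e1 := M.abs_slopeMap_sub_le_of_joined hα0 hα1 hK hH hC hD h ha
  have e2 := M.abs_slopeMap_sub_le hα0 hα1 hK hH h.mem.2 ha hb
  linarith [abs_sub_le (M.slopeMap i z a) (M.slopeMap i w a) (M.slopeMap i w b)]

/-! ## Variation of the slope -/

/-- The tangent directions of unstable manifolds are uniformly Lipschitz. -/
lemma abs_uSlope_sub_le (M : HyperbolicModel ι) {α K₀ C₀ : ℝ} (hα0 : 0 < α) (hα1 : α < 1)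
    (hK : 1 < K₀) (hH : M.Hyperbolic α K₀) (h5 : 1 / K₀ ^ 2 + α ^ 2 < 1) (hC : 0 < C₀)
    (hD : M.Distortion C₀) {ξ : ℕ → ι} {z w : ℝ × ℝ} (hz : z ∈ M.unstableSet ξ)
    (hw : w ∈ M.unstableSet ξ) :
    |M.uSlope ξ z.1 - M.uSlope ξ w.1| ≤
      distortionConst α C₀ / (1 - slopeRate α K₀) * ‖z - w‖ := by
  have hκ0 := slopeRate_pos hα0 hα1 hK
  have hκ1 := slopeRate_lt_one hα0 hα1 hK h5
  have hΛ := distortionConst_pos hα0 hα1 hC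
  have hslope : ∀ (ξ : ℕ → ι) {p : ℝ × ℝ}, p ∈ M.unstableSet ξ → |M.uSlope ξ p.1| ≤ α :=
    fun ξ p hp => (M.hasSlope_unstableFun hα0 hα1 hK hH h5 ξ (M.unstableSet_subset ξ hp).1).1
  set Λ := distortionConst α C₀
  set κ := slopeRate α K₀
  -- Fixed point of B ↦ κB + Λ. Going back one step multiplies slope differences by κ and adds Λ
  -- times a distance that does not grow backwards, so B‖z - w‖ reproduces itself while the initial
  -- error decays.
  set B := Λ / (1 - κ) with hB
  have hBκ : κ * B + Λ = B := by
    have : 1 - κ ≠ 0 := by linarith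
    rw [hB]; field_simp; ring
  have hB0 : 0 ≤ B := div_nonneg hΛ.le (by linarith)
  have key : ∀ n : ℕ, ∀ ξ : ℕ → ι, ∀ z ∈ M.unstableSet ξ, ∀ w ∈ M.unstableSet ξ,
      |M.uSlope ξ z.1 - M.uSlope ξ w.1| ≤ κ ^ n * (2 * α) + B * ‖z - w‖ := by
    intro n
    induction n with
    | zero =>
      intro ξ z hz w hw
      have := abs_sub (M.uSlope ξ z.1) (M.uSlope ξ w.1)
      have h1 : 0 ≤ B * ‖z - w‖ := by positivity
      rw [pow_zero]
      linarith [hslope ξ hz, hslope ξ hw]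
    | succ n ih =>
      intro ξ z hz w hw
      obtain ⟨z', hz', hzE, rfl⟩ := M.exists_preimage_of_mem_unstableSet hz
      obtain ⟨w', hw', hwE, rfl⟩ := M.exists_preimage_of_mem_unstableSet hw
      have hu := M.UCone_of_mem_unstableSet hα0 hα1 hK hH hz' hw'
      have hfu := M.f_UCone hα0 hα1 hK hH hzE hwE hu
      have hnorm : ‖z' - w'‖ ≤ ‖M.f (ξ 0) z' - M.f (ξ 0) w'‖ := by
        rw [norm_sub_eq_of_UCone hα1 hu, norm_sub_eq_of_UCone hα1 hfu.1]
        nlinarith [hfu.2, abs_nonneg (z'.1 - w'.1)]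
      rw [M.uSlope_image hα0 hα1 hK hH h5 hz' hzE, M.uSlope_image hα0 hα1 hK hH h5 hw' hwE]
      have h1 := M.abs_slopeMap_sub_slopeMap_le hα0 hα1 hK hH hC hD
        (M.lipJoined_of_UCone hα0 hα1 hK hH hzE hwE hu) (hslope _ hz') (hslope _ hw')
      have h2 := mul_le_mul_of_nonneg_left (ih _ z' hz' w' hw') hκ0.le
      have h3 := mul_le_mul_of_nonneg_left hnorm hB0
      calc _ ≤ κ * (κ ^ n * (2 * α) + B * ‖z' - w'‖) + Λ * ‖z' - w'‖ := by linarith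
        _ = κ ^ (n + 1) * (2 * α) + (κ * B + Λ) * ‖z' - w'‖ := by ring
        _ ≤ _ := by rw [hBκ]; linarith
  have hlim : Tendsto (fun n : ℕ => κ ^ n * (2 * α) + B * ‖z - w‖) atTop
      (𝓝 (0 * (2 * α) + B * ‖z - w‖)) :=
    ((tendsto_pow_atTop_nhds_zero_of_lt_one hκ0.le hκ1).mul_const _).add_const _
  rw [zero_mul, zero_add] at hlim
  exact ge_of_tendsto' hlim fun n => key n ξ z hz w hw

lemma norm_sub_le_one {z w : ℝ × ℝ} (hz : z ∈ unitSquare) (hw : w ∈ unitSquare) :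
    ‖z - w‖ ≤ 1 := by
  rw [Prod.norm_def]
  refine max_le ?_ ?_ <;> rw [Real.norm_eq_abs, abs_le]
  · exact ⟨by simp only [Prod.fst_sub]; linarith [hz.1.1, hw.1.2],
      by simp only [Prod.fst_sub]; linarith [hz.1.2, hw.1.1]⟩
  · exact ⟨by simp only [Prod.snd_sub]; linarith [hz.2.1, hw.2.2],
      by simp only [Prod.snd_sub]; linarith [hz.2.2, hw.2.1]⟩

lemma future_iterate_shift {ω ω' : ℤ → ι} (h : future ω = future ω') (k : ℕ) :
    future (shift^[k] ω) = future (shift^[k] ω') := by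
  induction k with
  | zero => exact h
  | succ k ih => rw [Function.iterate_succ_apply', Function.iterate_succ_apply', future_shift,
      future_shift, ih]

lemma apply_zero_eq_of_future_eq {ω ω' : ℤ → ι} (h : future ω = future ω') : ω 0 = ω' 0 := by
  rw [← future_zero ω, h, future_zero]

/-- Points of the same stable manifold approach each other under iteration. -/
lemma norm_point_sub_le_of_future_eq (M : HyperbolicModel ι) {α K₀ : ℝ} (hα0 : 0 < α)
    (hα1 : α < 1) (hK : 1 < K₀) (hH : M.Hyperbolic α K₀) {ω ω' : ℤ → ι}
    (h : future ω = future ω') (k : ℕ) :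
    ‖M.point (shift^[k] ω) - M.point (shift^[k] ω')‖ ≤ (1 / K₀) ^ k := by
  have hcone : ∀ k, SCone α (M.point (shift^[k] ω)) (M.point (shift^[k] ω')) := fun k =>
    M.SCone_of_mem_stableSet hα0 hα1 hK hH (M.point_mem hα0 hα1 hK hH _).1
      (future_iterate_shift h k ▸ (M.point_mem hα0 hα1 hK hH _).1)
  induction k with
  | zero =>
    rw [pow_zero]
    exact norm_sub_le_one (M.unstableSet_subset _ (M.point_mem hα0 hα1 hK hH _).2)
      (M.unstableSet_subset _ (M.point_mem hα0 hα1 hK hH _).2)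
  | succ k ih =>
    have h1 := hcone (k + 1)
    have h0 := apply_zero_eq_of_future_eq (future_iterate_shift h k)
    rw [norm_sub_eq_of_SCone hα1 h1]
    rw [norm_sub_eq_of_SCone hα1 (hcone k)] at ih
    rw [Function.iterate_succ_apply', Function.iterate_succ_apply',
      ← M.f_point hα0 hα1 hK hH, ← M.f_point hα0 hα1 hK hH, ← h0] at h1 ⊢
    have h2 := (M.f_SCone hα0 hα1 hK hH (M.point_mem_E hα0 hα1 hK hH _)
      (h0 ▸ M.point_mem_E hα0 hα1 hK hH _) h1).2
    rw [pow_succ, mul_one_div, le_div_iff₀ (by linarith)]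
    linarith

/-- Along the same stable manifold, `φ ∘ Fᵏ` varies exponentially little. -/
lemma abs_phi_iterate_sub_le (M : HyperbolicModel ι) {α K₀ C₀ μ : ℝ} (hα0 : 0 < α)
    (hα1 : α < 1) (hK : 1 < K₀) (hH : M.Hyperbolic α K₀) (h5 : 1 / K₀ ^ 2 + α ^ 2 < 1)
    (hC : 0 < C₀) (hD : M.Distortion C₀) (hμ : slopeRate α K₀ < μ) (hμK : 1 / K₀ ≤ μ)
    {ω ω' : ℤ → ι} (h : future ω = future ω') (k : ℕ) :
    |M.phi (shift^[k] ω) - M.phi (shift^[k] ω')| ≤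
      (distortionConst α C₀ + 1 / (1 - α ^ 2) *
        (2 + distortionConst α C₀ / (μ - slopeRate α K₀))) * μ ^ k := by
  have hκ0 := slopeRate_pos hα0 hα1 hK
  have hΛ := distortionConst_pos hα0 hα1 hC
  have hα2 : 0 < 1 - α ^ 2 := by nlinarith
  have hμ0 : 0 < μ := hκ0.trans hμ
  set Λ := distortionConst α C₀
  set κ := slopeRate α K₀
  -- Makes Bμᵏ a supersolution of s(k+1) = κ s(k) + Λμᵏ. The summand 2 covers k = 0, where each
  -- slope is at most 1 in modulus, and μ > κ strictly avoids resonance.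
  set B := 2 + Λ / (μ - κ) with hB
  have hBμ : Λ ≤ B * (μ - κ) := by
    rw [hB, add_mul, div_mul_cancel₀ _ (by linarith)]; linarith
  have hB2 : 2 ≤ B := by
    have : 0 ≤ Λ / (μ - κ) := div_nonneg hΛ.le (by linarith)
    linarith
  have hdist : ∀ k, ‖M.point (shift^[k] ω) - M.point (shift^[k] ω')‖ ≤ μ ^ k := fun k =>
    (M.norm_point_sub_le_of_future_eq hα0 hα1 hK hH h k).trans
      (pow_le_pow_left₀ (by have : 0 < K₀ := by linarith
                            positivity) hμK k)
  have h0 : ∀ k, (shift^[k] ω) 0 = (shift^[k] ω') 0 := fun k =>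
    apply_zero_eq_of_future_eq (future_iterate_shift h k)
  have hjoin : ∀ k, LipJoined (M.E ((shift^[k] ω) 0)) (M.point (shift^[k] ω))
      (M.point (shift^[k] ω')) := fun k => by
    have := M.lipJoined_of_mem_stableSet hα0 hα1 hK hH
      (M.point_mem hα0 hα1 hK hH (shift^[k] ω)).1
      (future_iterate_shift h k ▸ (M.point_mem hα0 hα1 hK hH (shift^[k] ω')).1)
    rwa [future_zero] at this
  have hslope := M.abs_unstableSlope_le hα0 hα1 hK hH h5
  have key : ∀ k, |M.unstableSlope (shift^[k] ω) - M.unstableSlope (shift^[k] ω')| ≤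
      B * μ ^ k := by
    intro k
    induction k with
    | zero =>
      have := abs_sub (M.unstableSlope (shift^[0] ω)) (M.unstableSlope (shift^[0] ω'))
      rw [pow_zero]
      linarith [hslope (shift^[0] ω), hslope (shift^[0] ω')]
    | succ k ih =>
      rw [Function.iterate_succ_apply', Function.iterate_succ_apply',
        M.unstableSlope_shift hα0 hα1 hK hH h5, M.unstableSlope_shift hα0 hα1 hK hH h5, ← h0 k]
      have h1 := M.abs_slopeMap_sub_slopeMap_le hα0 hα1 hK hH hC hD (hjoin k)
        (hslope (shift^[k] ω)) (hslope (shift^[k] ω'))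
      have h2 := mul_le_mul_of_nonneg_left ih hκ0.le
      have h3 := mul_le_mul_of_nonneg_left (hdist k) hΛ.le
      have h4 : Λ * μ ^ k ≤ B * (μ - κ) * μ ^ k := mul_le_mul_of_nonneg_right hBμ (by positivity)
      calc _ ≤ κ * (B * μ ^ k) + Λ * μ ^ k := by linarith
        _ ≤ κ * (B * μ ^ k) + B * (μ - κ) * μ ^ k := by linarith
        _ = _ := by ring
  have h1 := M.abs_phi_sub_le hα0 hα1 hK hH h5 hC hD (h0 k) (hjoin k)
  have h2 := mul_le_mul_of_nonneg_left (hdist k) hΛ.le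
  have h3 : 1 / (1 - α ^ 2) * _ ≤ _ :=
    mul_le_mul_of_nonneg_left (key k) (by positivity : (0 : ℝ) ≤ 1 / (1 - α ^ 2))
  calc _ ≤ Λ * μ ^ k + 1 / (1 - α ^ 2) * (B * μ ^ k) := by linarith
    _ = _ := by ring

lemma past_shift_eq {ω ω' : ℤ → ι} (hp : past ω = past ω') (h0 : ω 0 = ω' 0) :
    past (shift ω) = past (shift ω') := by
  funext k
  cases k with
  | zero => rw [past_shift_zero, past_shift_zero, h0]
  | succ k =>
    rw [← past_shift_succ ω, ← past_shift_succ ω'] at hp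
    exact congrFun hp k

/-- Points of the same unstable manifold with the same itinerary up to time `n` are close. -/
lemma norm_point_sub_le_of_past_eq (M : HyperbolicModel ι) {α K₀ : ℝ} (hα0 : 0 < α)
    (hα1 : α < 1) (hK : 1 < K₀) (hH : M.Hyperbolic α K₀) (n : ℕ) {ω ω' : ℤ → ι}
    (hp : past ω = past ω') (hf : ∀ i < n, future ω i = future ω' i) :
    ‖M.point ω - M.point ω'‖ ≤ (1 / K₀) ^ n := by
  induction n generalizing ω ω' with
  | zero =>
    rw [pow_zero]
    exact norm_sub_le_one (M.unstableSet_subset _ (M.point_mem hα0 hα1 hK hH _).2)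
      (M.unstableSet_subset _ (M.point_mem hα0 hα1 hK hH _).2)
  | succ n ih =>
    have h0 : ω 0 = ω' 0 := by
      rw [← future_zero ω, ← future_zero ω']; exact hf 0 (Nat.succ_pos n)
    have h1 := ih (past_shift_eq hp h0) fun i hi => by
      rw [future_shift, future_shift]; exact hf (i + 1) (by omega)
    have hu : UCone α (M.point ω) (M.point ω') :=
      M.UCone_of_mem_unstableSet hα0 hα1 hK hH (M.point_mem hα0 hα1 hK hH ω).2
        (hp ▸ (M.point_mem hα0 hα1 hK hH ω').2)
    have h2 := M.f_UCone hα0 hα1 hK hH (M.point_mem_E hα0 hα1 hK hH ω)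
      (h0 ▸ M.point_mem_E hα0 hα1 hK hH ω') hu
    rw [← M.f_point hα0 hα1 hK hH, ← M.f_point hα0 hα1 hK hH, ← h0,
      norm_sub_eq_of_UCone hα1 h2.1] at h1
    rw [norm_sub_eq_of_UCone hα1 hu, pow_succ, mul_one_div, le_div_iff₀ (by linarith)]
    linarith [h2.2]

/-- On a common unstable manifold the slope is a Lipschitz function of the point, so φ inherits the
K₀⁻ⁿ closeness of the points. At least one common symbol is needed to have a single map f. -/
lemma abs_phi_sub_le_of_past_eq (M : HyperbolicModel ι) {α K₀ C₀ : ℝ} (hα0 : 0 < α)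
    (hα1 : α < 1) (hK : 1 < K₀) (hH : M.Hyperbolic α K₀) (h5 : 1 / K₀ ^ 2 + α ^ 2 < 1)
    (hC : 0 < C₀) (hD : M.Distortion C₀) {n : ℕ} (hn : 0 < n) {ω ω' : ℤ → ι}
    (hp : past ω = past ω') (hf : ∀ i < n, future ω i = future ω' i) :
    |M.phi ω - M.phi ω'| ≤ (distortionConst α C₀ + 1 / (1 - α ^ 2) *
      (distortionConst α C₀ / (1 - slopeRate α K₀))) * (1 / K₀) ^ n := by
  have hκ1 := slopeRate_lt_one hα0 hα1 hK h5
  have hΛ := distortionConst_pos hα0 hα1 hC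
  have hα2 : 0 < 1 - α ^ 2 := by nlinarith
  have hB : 0 ≤ distortionConst α C₀ / (1 - slopeRate α K₀) := div_nonneg hΛ.le (by linarith)
  have hz := (M.point_mem hα0 hα1 hK hH ω).2
  have hw : M.point ω' ∈ M.unstableSet (past ω) := hp ▸ (M.point_mem hα0 hα1 hK hH ω').2
  have h0 : ω 0 = ω' 0 := by
    rw [← future_zero ω, ← future_zero ω']; exact hf 0 hn
  have h1 := M.abs_phi_sub_le hα0 hα1 hK hH h5 hC hD h0
    (M.lipJoined_of_UCone hα0 hα1 hK hH (M.point_mem_E hα0 hα1 hK hH ω)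
      (h0 ▸ M.point_mem_E hα0 hα1 hK hH ω') (M.UCone_of_mem_unstableSet hα0 hα1 hK hH hz hw))
  have h2 := M.abs_uSlope_sub_le hα0 hα1 hK hH h5 hC hD hz hw
  have h3 := M.norm_point_sub_le_of_past_eq hα0 hα1 hK hH n hp hf
  rw [unstableSlope_eq, unstableSlope_eq, ← hp] at h1
  have h4 : 1 / (1 - α ^ 2) * _ ≤ _ :=
    mul_le_mul_of_nonneg_left h2 (by positivity : (0 : ℝ) ≤ 1 / (1 - α ^ 2))
  refine le_trans ?_ (mul_le_mul_of_nonneg_left h3 (by positivity))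
  linarith

/-! ## The cohomologous function of the future -/

/-- The reference orbit of σω is (σω)₀, which has past η and in general differs from σ(ω₀). -/
lemma uTerm_shift (M : HyperbolicModel ι) (η : ℕ → ι) (k : ℕ) (ω : ℤ → ι) :
    M.uTerm η k (shift ω) =
      M.phi (shift^[k + 1] ω) - M.phi (shift^[k] (glue η fun j => future ω (j + 1))) := by
  rw [uTerm, future_shift, Function.iterate_succ_apply]

/-- With N terms in both series, the φ(σᵏω) telescope and the past of ω survives only in φ(σᴺω).
Comparison with ω₀ leaves exactly the N-th term of u, which tends to 0. -/
lemma psi_eq_phiU (M : HyperbolicModel ι) {η : ℕ → ι}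
    (hs : ∀ ω : ℤ → ι, Summable fun k => M.uTerm η k ω) (ω : ℤ → ι) :
    M.psi η ω = M.phiU η (future ω) := by
  have hpart : ∀ ω : ℤ → ι, Tendsto (fun N : ℕ => M.phi ω -
      ∑ k ∈ Finset.range N, M.uTerm η k ω + ∑ k ∈ Finset.range N, M.uTerm η k (shift ω)) atTop
      (𝓝 (M.psi η ω)) := fun ω =>
    ((hs ω).hasSum.tendsto_sum_nat.const_sub _).add (hs (shift ω)).hasSum.tendsto_sum_nat
  have hdiff := (hpart ω).sub (hpart (glue η (future ω)))
  have heq : ∀ N : ℕ, (M.phi ω - ∑ k ∈ Finset.range N, M.uTerm η k ω +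
      ∑ k ∈ Finset.range N, M.uTerm η k (shift ω)) -
      (M.phi (glue η (future ω)) - ∑ k ∈ Finset.range N, M.uTerm η k (glue η (future ω)) +
      ∑ k ∈ Finset.range N, M.uTerm η k (shift (glue η (future ω)))) = M.uTerm η N ω := by
    intro N
    induction N with
    | zero => simp [uTerm]
    | succ N ih =>
      simp only [Finset.sum_range_succ]
      have h1 := M.uTerm_shift η N ω
      have h2 := M.uTerm_shift η N (glue η (future ω))
      rw [future_glue] at h2
      have h3 : M.uTerm η N (glue η (future ω)) = 0 := by
        rw [uTerm, future_glue, sub_self]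
      have h4 : M.uTerm η (N + 1) ω = M.phi (shift^[N + 1] ω) -
        M.phi (shift^[N + 1] (glue η (future ω))) := rfl
      linarith
  simp only [heq] at hdiff
  exact sub_eq_zero.1 (tendsto_nhds_unique hdiff (hs ω).tendsto_atTop_zero)

lemma agree_iterate_shift {ω ω' : ℤ → ι} {n : ℕ} (hp : past ω = past ω')
    (hf : ∀ i < n, future ω i = future ω' i) {k : ℕ} (hk : k ≤ n) :
    past (shift^[k] ω) = past (shift^[k] ω') ∧
      ∀ i < n - k, future (shift^[k] ω) i = future (shift^[k] ω') i := by
  induction k with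
  | zero => exact ⟨hp, hf⟩
  | succ k ih =>
    obtain ⟨h1, h2⟩ := ih (by omega)
    rw [Function.iterate_succ_apply', Function.iterate_succ_apply']
    refine ⟨past_shift_eq h1 ?_, fun i hi => ?_⟩
    · rw [← future_zero (shift^[k] ω), ← future_zero (shift^[k] ω')]; exact h2 0 (by omega)
    · rw [future_shift, future_shift]; exact h2 (i + 1) (by omega)

lemma phiU_eq (M : HyperbolicModel ι) (η x : ℕ → ι) :
    M.phiU η x = M.phi (glue η x) + ∑' k, M.uTerm η k (shift (glue η x)) := by
  have : ∀ k, M.uTerm η k (glue η x) = 0 := fun k => by rw [uTerm, future_glue, sub_self]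
  rw [phiU, psi, u, u]
  simp [this]

/-- The cube pays for the splitting at k = n/2 in `locallyHolder_phiU` and still leaves a factor νᵏ
to sum. With d = (1 - max m 0)/4 one has (1-d)³ ≥ 1 - 3d > 1 - 4d. -/
lemma exists_rate {m : ℝ} (hm : m < 1) : ∃ ν, 0 < ν ∧ ν < 1 ∧ m < ν ^ 3 := by
  refine ⟨1 - (1 - max m 0) / 4, ?_, ?_, ?_⟩ <;>
    have h0 := le_max_right m 0 <;> have h1 := le_max_left m 0 <;>
    have h2 : max m 0 < 1 := max_lt hm one_pos
  · linarith
  · linarith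
  · set d := (1 - max m 0) / 4 with hd
    have hd0 : 0 < d := by linarith
    have hd1 : d ≤ 1 := by linarith
    nlinarith [mul_nonneg (mul_nonneg hd0.le hd0.le) (by linarith : 0 ≤ 3 - d)]

lemma locallyHolder_of_le {g : (ℕ → ι) → ℝ} {C θ : ℝ} (hC : 0 ≤ C) (hθ0 : 0 < θ) (hθ1 : θ < 1)
    (h : ∀ n : ℕ, 1 ≤ n → ∀ x y : ℕ → ι, (∀ i < n, x i = y i) → |g x - g y| ≤ C * θ ^ n) :
    LocallyHolder g := by
  -- The 1 turns ≤ into the required strict inequality.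
  refine ⟨C + 1, θ, by linarith, hθ0, hθ1, fun n hn => ?_⟩
  have hθn : 0 < θ ^ n := by positivity
  refine lt_of_le_of_lt (b := ENNReal.ofReal (C * θ ^ n)) ?_ ?_
  · exact iSup_le fun x => iSup_le fun y => iSup_le fun hxy =>
      ENNReal.ofReal_le_ofReal (h n hn x y hxy)
  · exact (ENNReal.ofReal_lt_ofReal_iff (by positivity)).2 (by nlinarith)

lemma locallyHolder_phiU (M : HyperbolicModel ι) {η : ℕ → ι} {ν A B : ℝ} (hν0 : 0 < ν)
    (hν1 : ν < 1) (hA : 0 ≤ A) (hB : 0 ≤ B)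
    (hstable : ∀ ω ω' : ℤ → ι, future ω = future ω' → ∀ k : ℕ,
      |M.phi (shift^[k] ω) - M.phi (shift^[k] ω')| ≤ A * (ν ^ 3) ^ k)
    (hunstable : ∀ n : ℕ, 0 < n → ∀ ω ω' : ℤ → ι, past ω = past ω' →
      (∀ i < n, future ω i = future ω' i) → |M.phi ω - M.phi ω'| ≤ B * (ν ^ 3) ^ n)
    (hs : ∀ ω : ℤ → ι, Summable fun k => M.uTerm η k ω) :
    LocallyHolder (M.phiU η) := by
  have hν' : 0 < 1 - ν := by linarith
  have hpow : ∀ {i j : ℕ}, i ≤ j → ν ^ j ≤ ν ^ i := fun h =>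
    pow_le_pow_of_le_one hν0.le hν1.le h
  refine locallyHolder_of_le (C := B + 2 * (A + B) / (ν * (1 - ν))) (by positivity) hν0 hν1 ?_
  intro n hn x y hxy
  -- The series is evaluated at the shifted sequences, which have one common symbol less.
  obtain ⟨n, rfl⟩ : ∃ m, n = m + 1 := ⟨n - 1, by omega⟩
  rw [phiU_eq, phiU_eq]
  set ω := glue η x with hω
  set ω' := glue η y with hω'
  have hp : past ω = past ω' := by rw [hω, hω', past_glue, past_glue]
  have hf : ∀ i < n + 1, future ω i = future ω' i := hxy
  set ζ := glue η fun j => x (j + 1) with hζ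
  set ζ' := glue η fun j => y (j + 1) with hζ'
  have hpζ : past ζ = past ζ' := by rw [hζ, hζ', past_glue, past_glue]
  have hfζ : ∀ i < n, future ζ i = future ζ' i := fun i hi => hxy (i + 1) (by omega)
  have hterm : ∀ k, |M.uTerm η k (shift ω) - M.uTerm η k (shift ω')| ≤
      (2 * (A + B) * ν ^ n) * ν ^ k := by
    intro k
    -- For n ≤ 2k each of the two terms is small by itself, as 3k ≥ n + k. For 2k < n the sequences
    -- for x and y are compared with each other, n - k symbols still agree, and 3(n - k) ≥ n + k.
    rcases le_or_gt n (2 * k) with hk | hk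
    · have h1 := hstable (shift ω) (glue η (future (shift ω))) rfl k
      have h2 := hstable (shift ω') (glue η (future (shift ω'))) rfl k
      have h3 := abs_sub (M.uTerm η k (shift ω)) (M.uTerm η k (shift ω'))
      have h4 : (ν ^ 3) ^ k ≤ ν ^ n * ν ^ k := by
        rw [← pow_mul, ← pow_add]; exact hpow (by omega)
      have h5 := mul_le_mul_of_nonneg_left h4 hA
      have h6 : 0 ≤ B * (ν ^ n * ν ^ k) := by positivity
      unfold uTerm at h3 ⊢
      linarith
    · rw [uTerm_shift, uTerm_shift]
      obtain ⟨p1, p2⟩ := agree_iterate_shift hp hf (k := k + 1) (by omega)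
      obtain ⟨q1, q2⟩ := agree_iterate_shift hpζ hfζ (k := k) (by omega)
      have h1 := hunstable (n + 1 - (k + 1)) (by omega) _ _ p1 p2
      have h2 := hunstable (n - k) (by omega) _ _ q1 q2
      have h3 : ∀ j, n - k ≤ j → B * (ν ^ 3) ^ j ≤ B * (ν ^ n * ν ^ k) := fun j hj => by
        refine mul_le_mul_of_nonneg_left ?_ hB
        rw [← pow_mul, ← pow_add]; exact hpow (by omega)
      have h4 := h3 (n + 1 - (k + 1)) (by omega)
      have h5 := h3 (n - k) le_rfl
      have h6 : 0 ≤ A * (ν ^ n * ν ^ k) := by positivity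
      have h7 := abs_sub (M.phi (shift^[k + 1] ω) - M.phi (shift^[k + 1] ω'))
        (M.phi (shift^[k] ζ) - M.phi (shift^[k] ζ'))
      calc _ = |(M.phi (shift^[k + 1] ω) - M.phi (shift^[k + 1] ω')) -
            (M.phi (shift^[k] ζ) - M.phi (shift^[k] ζ'))| := by
            rw [hζ, hζ', hω, hω', future_glue, future_glue]; congr 1; ring
        _ ≤ _ := by linarith
  have hsum : |∑' k, M.uTerm η k (shift ω) - ∑' k, M.uTerm η k (shift ω')| ≤
      (2 * (A + B) * ν ^ n) * (1 - ν)⁻¹ := by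
    rw [← (hs (shift ω)).tsum_sub (hs (shift ω'))]
    exact tsum_of_norm_bounded
      (f := fun k => M.uTerm η k (shift ω) - M.uTerm η k (shift ω'))
      ((hasSum_geometric_of_lt_one hν0.le hν1).mul_left _) hterm
  have hfirst := hunstable (n + 1) (Nat.succ_pos n) ω ω' hp hf
  have h1 : B * (ν ^ 3) ^ (n + 1) ≤ B * ν ^ (n + 1) := by
    refine mul_le_mul_of_nonneg_left ?_ hB
    rw [← pow_mul]; exact hpow (by omega)
  have h2 : (2 * (A + B) * ν ^ n) * (1 - ν)⁻¹ = 2 * (A + B) / (ν * (1 - ν)) * ν ^ (n + 1) := by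
    rw [pow_succ]; field_simp
  calc _ = |(M.phi ω - M.phi ω') +
        (∑' k, M.uTerm η k (shift ω) - ∑' k, M.uTerm η k (shift ω'))| := by congr 1; ring
    _ ≤ _ := abs_add_le _ _
    _ ≤ _ := by linarith

end HyperbolicModel

end

/-! ### Assembly of the corollary. -/

theorem corollary5p10 {ι : Type*} [Countable ι] (M : HyperbolicModel ι) (α K₀ : ℝ)
    (hα0 : 0 < α) (hα1 : α < 1) (hK : 1 < K₀)
    (hG : M.Geometric) (hH : M.Hyperbolic α K₀)
    (hH5 : 1 / K₀ ^ 2 + α ^ 2 < 1)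
    (hD2 : ∃ C₀ : ℝ, 0 < C₀ ∧ M.Distortion C₀)
    (η : ℕ → ι) :
    -- unstable manifolds are graphs of functions of class C¹ with slope at most α
    (∀ ξ : ℕ → ι,
      M.unstableSet ξ = {z | z.1 ∈ Icc (0 : ℝ) 1 ∧ z.2 = M.unstableFun ξ z.1} ∧
      ContDiffOn ℝ 1 (M.unstableFun ξ) (Icc 0 1) ∧
      ∀ x ∈ Icc (0 : ℝ) 1, |derivWithin (M.unstableFun ξ) (Icc 0 1) x| ≤ α) ∧
    -- every two-sided sequence codes exactly one point, and F acts as the shift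
    (∀ ω : ℤ → ι,
      M.stableSet (HyperbolicModel.future ω) ∩ M.unstableSet (HyperbolicModel.past ω)
        = {M.point ω} ∧
      M.f (ω 0) (M.point ω) = M.point (HyperbolicModel.shift ω)) ∧
    -- the series u converges, uniformly
    (∀ ω : ℤ → ι, Summable fun k => M.uTerm η k ω) ∧
    TendstoUniformly (fun (N : ℕ) (ω : ℤ → ι) => ∑ k ∈ Finset.range N, M.uTerm η k ω)
      (M.u η) atTop ∧
    -- ψ = φ - u + u ∘ F depends only on the future, so that it is a function φᵘ on Ω₊
    (∀ ω : ℤ → ι, M.psi η ω = M.phiU η (HyperbolicModel.future ω)) ∧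
    -- φᵘ is locally Hölder
    HyperbolicModel.LocallyHolder (M.phiU η) := by
  obtain ⟨C₀, hC, hD⟩ := hD2
  have hκ0 := HyperbolicModel.slopeRate_pos hα0 hα1 hK
  have hκ1 := HyperbolicModel.slopeRate_lt_one hα0 hα1 hK hH5
  have hΛ := HyperbolicModel.distortionConst_pos hα0 hα1 hC
  have hα2 : 0 < 1 - α ^ 2 := by nlinarith
  have hK1 : 1 / K₀ < 1 := by rw [div_lt_one (by linarith)]; exact hK
  have hK0 : 0 < K₀ := by linarith
  -- One rate ν³ dominates both the contraction of slopes and that of distances.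
  obtain ⟨ν, hν0, hν1, hν⟩ := HyperbolicModel.exists_rate (max_lt hκ1 hK1)
  have hμκ := (le_max_left _ _).trans_lt hν
  have hμK := ((le_max_right _ _).trans_lt hν).le
  have hA := fun ω ω' h k =>
    M.abs_phi_iterate_sub_le (ω := ω) (ω' := ω') hα0 hα1 hK hH hH5 hC hD hμκ hμK h k
  have hB := fun n hn ω ω' hp hf =>
    M.abs_phi_sub_le_of_past_eq (n := n) (ω := ω) (ω' := ω') hα0 hα1 hK hH hH5 hC hD hn hp hf
  set A := HyperbolicModel.distortionConst α C₀ + 1 / (1 - α ^ 2) *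
    (2 + HyperbolicModel.distortionConst α C₀ / (ν ^ 3 - HyperbolicModel.slopeRate α K₀))
  set B := HyperbolicModel.distortionConst α C₀ + 1 / (1 - α ^ 2) *
    (HyperbolicModel.distortionConst α C₀ / (1 - HyperbolicModel.slopeRate α K₀))
  have hA0 : 0 ≤ A := by
    have : 0 < ν ^ 3 - HyperbolicModel.slopeRate α K₀ := by linarith
    positivity
  have hB0 : 0 ≤ B := by
    have : 0 < 1 - HyperbolicModel.slopeRate α K₀ := by linarith
    positivity
  have hν3 : ν ^ 3 < 1 := pow_lt_one₀ hν0.le hν1 (by norm_num)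
  have hgeom : Summable fun k : ℕ => A * (ν ^ 3) ^ k :=
    (summable_geometric_of_lt_one (by positivity) hν3).mul_left A
  have hterm : ∀ (k : ℕ) (ω : ℤ → ι), ‖M.uTerm η k ω‖ ≤ A * (ν ^ 3) ^ k := fun k ω =>
    hA ω (HyperbolicModel.glue η (HyperbolicModel.future ω)) rfl k
  have hs : ∀ ω : ℤ → ι, Summable fun k => M.uTerm η k ω := fun ω =>
    Summable.of_norm_bounded hgeom fun k => hterm k ω
  refine ⟨fun ξ => ⟨Set.ext fun z => M.mem_unstableSet_iff hα0 hα1 hK hH,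
    M.contDiffOn_unstableFun hα0 hα1 hK hH hH5 ξ,
    fun x hx => (M.hasSlope_unstableFun hα0 hα1 hK hH hH5 ξ hx).1⟩,
    fun ω => ⟨?_, M.f_point hα0 hα1 hK hH ω⟩, hs, tendstoUniformly_tsum_nat hgeom hterm,
    M.psi_eq_phiU hs, ?_⟩
  · exact eq_singleton_iff_unique_mem.2
      ⟨M.point_mem hα0 hα1 hK hH ω, fun z hz => M.eq_point hα0 hα1 hK hH hz⟩
  · refine M.locallyHolder_phiU hν0 hν1 hA0 hB0 hA (fun n hn ω ω' hp hf => ?_) hs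
    exact (hB n hn ω ω' hp hf).trans
      (mul_le_mul_of_nonneg_left (pow_le_pow_left₀ (by positivity) hμK n) hB0)
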